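/- Let $K$ be a number field with ring of integers $R$. Let $G = N \rtimes Q$ be the semidirect product of two finite groups $N$ and $Q$, with $N$ abelian. Assume that $K$ contains a primitive root of unity of order the exponent of $N$, i.e. that the group algebra $KN$ splits. For a finite abelian group $A$ of exponent dividing that of $N$, write $\widehat A = \mathrm{Hom}(A, K^{\times})$, with trivial element $\varepsilon$, and, for $\phi \in \widehat A$, let $e^A_\phi = \frac{1}{|A|}\sum_{a \in A} \phi(a^{-1})\,a \in KA$ be the corresponding primitive idempotent. Let $Q$ act on $\widehat N$ by $(q \triangleright \nu)(n) = \nu(q^{-1}\cdot n)$; for $q \in Q$, write $N^q$ and $\widehat N^q$ for the subgroups of elements fixed by $q$. Let $L \le N$ and $P \le Q$ be abelian subgroups, let $\tau \in Q$, and put $M = LP \le G$. Suppose that: (i) $L$ and $P$ are isomorphic and commute with one another; (ii) $Q$ acts faithfully on $N$; (iii) $N = L \oplus (\tau \cdot L)$ (with $N$ written additively); (iv) $N^{\tau} \neq \{1\}$; (v) $\widehat N^{\sigma\tau} = \{\varepsilon\}$ and $\widehat N^{\tau} \cap \widehat N^{\sigma\tau\sigma^{-1}} = \{\varepsilon\}$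 for every $\sigma \in P$ with $\sigma \neq 1$. Let $f : P \to \widehat L$ be an isomorphism. Define the $2$-cocycle $\omega$ on $\widehat M$ by $\omega(\phi, \psi) = \psi\big(f^{-1}(\phi|_L)\big)$ for $\phi, \psi \in \widehat M$, and let $$J = \sum_{\phi,\psi \in \widehat M} \omega(\phi,\psi)\, e^M_\phi \otimes e^M_\psi$$ be the twist of $KG$ arising from $f$. Let $(KG)_J$ be the corresponding Drinfeld twist: it is the algebra $KG$ with the counit of $KG$, the coproduct $\Delta_J(h) = J\Delta(h)J^{-1}$ and the antipode $S_J(h) = U_J S(h) U_J^{-1}$, where $U_J = \sum J^{(1)} S(J^{(2)})$ for $J = \sum J^{(1)} \otimes J^{(2)}$. A Hopf order over $R$ of a finite-dimensional Hopf algebra $H$ over $K$ is a finitely generated projective $R$-submodule $X \subseteq H$ such that the natural map $X \otimes_R K \to H$ is an isomorphism, $1 \in X$, $XX \subseteq X$, $\Delta(X) \subseteq X \otimes_R X$, $\varepsilon(X) \subseteq R$ and $S(X) \subseteq X$, where $X \otimes_R X$ is identified with its image in $H \otimes_K H$. Then $(KG)_J$ has a unique Hopf order over $R$. It is the $R$-subalgebra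 of $KG$ generated by the primitive idempotents $e^N_\nu$, $\nu \in \widehat N$, of $KN$ and the elements of $Q$. -/

import Mathlib

open scoped TensorProduct

/-- A (Drinfeld) twist for a Hopf algebra `H` over `K`: an invertible `J ∈ H ⊗ H` with
`(1 ⊗ J)(id ⊗ Δ)(J) = (J ⊗ 1)(Δ ⊗ id)(J)` and `(ε ⊗ id)(J) = (id ⊗ ε)(J) = 1`. -/
structure DrinfeldTwist (K H : Type*) [CommRing K] [Ring H] [HopfAlgebra K H] where
  /-- The element `J`, as a unit of `H ⊗ H`. -/
  val : (H ⊗[K] H)ˣ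
  cocycle :
    ((1 : H) ⊗ₜ[K] (val : H ⊗[K] H)) *
        Algebra.TensorProduct.map (AlgHom.id K H) (Bialgebra.comulAlgHom K H) (val : H ⊗[K] H) =
      Algebra.TensorProduct.assoc K K K H H H
        (((val : H ⊗[K] H) ⊗ₜ[K] (1 : H)) *
          Algebra.TensorProduct.map (Bialgebra.comulAlgHom K H) (AlgHom.id K H)
            (val : H ⊗[K] H))
  counit_left :
    Algebra.TensorProduct.lid K H
      (Algebra.TensorProduct.map (Bialgebra.counitAlgHom K H) (AlgHom.id K H)
        (val : H ⊗[K] H)) = 1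
  counit_right :
    Algebra.TensorProduct.rid K K H
      (Algebra.TensorProduct.map (AlgHom.id K H) (Bialgebra.counitAlgHom K H)
        (val : H ⊗[K] H)) = 1

namespace DrinfeldTwist

section

variable {K H : Type*} [CommRing K] [Ring H] [HopfAlgebra K H] (J : DrinfeldTwist K H)

/-- The underlying algebra of the twisted Hopf algebra `H_J`: a copy of `H`. -/
def Twisted (_J : DrinfeldTwist K H) : Type _ := H

noncomputable instance : Ring J.Twisted := inferInstanceAs (Ring H)

noncomputable instance {R : Type*} [CommSemiring R] [Algebra R H] : Algebra R J.Twisted :=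
  inferInstanceAs (Algebra R H)

instance {R : Type*} [CommSemiring R] [Algebra R K] [Algebra R H] [IsScalarTower R K H] :
    IsScalarTower R K J.Twisted :=
  inferInstanceAs (IsScalarTower R K H)

/-- The identity map `H → H_J`, an isomorphism of algebras. -/
noncomputable def toTwisted : H ≃ₐ[K] J.Twisted := AlgEquiv.refl

/-- The conjugation `x ↦ J x J⁻¹` on `H ⊗ H`. -/
noncomputable def conj : H ⊗[K] H →ₐ[K] H ⊗[K] H :=
  AlgHom.ofLinearMap
    (LinearMap.mulRight K (↑J.val⁻¹ : H ⊗[K] H) ∘ₗ LinearMap.mulLeft K (J.val : H ⊗[K] H))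
    (by simp) (by intro x y; simp [mul_assoc])

/-- `Δ_J(h) = J Δ(h) J⁻¹`. -/
noncomputable def comulTw : H →ₐ[K] H ⊗[K] H := J.conj.comp (Bialgebra.comulAlgHom K H)

lemma comulTw_apply (h : H) :
    J.comulTw h = (J.val : H ⊗[K] H) * Coalgebra.comul h * (↑J.val⁻¹ : H ⊗[K] H) := rfl

/-- `U_J = ∑ J⁽¹⁾ S(J⁽²⁾)`. -/
noncomputable def U : H :=
  LinearMap.mul' K H ((HopfAlgebra.antipode K).lTensor H (J.val : H ⊗[K] H))

/-- `U_J⁻¹ = ∑ S(J⁻⁽¹⁾) J⁻⁽²⁾`. -/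
noncomputable def Uinv : H :=
  LinearMap.mul' K H ((HopfAlgebra.antipode K).rTensor H (↑J.val⁻¹ : H ⊗[K] H))

/-- `S_J(h) = U_J S(h) U_J⁻¹`. -/
noncomputable def antipodeTw : H →ₗ[K] H :=
  LinearMap.mulRight K J.Uinv ∘ₗ LinearMap.mulLeft K J.U ∘ₗ HopfAlgebra.antipode K

lemma antipodeTw_apply (h : H) :
    J.antipodeTw h = J.U * HopfAlgebra.antipode K h * J.Uinv := rfl

lemma cocycle_inv :
    Algebra.TensorProduct.map (AlgHom.id K H) (Bialgebra.comulAlgHom K H)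
        (↑J.val⁻¹ : H ⊗[K] H) * ((1 : H) ⊗ₜ[K] (↑J.val⁻¹ : H ⊗[K] H)) =
      Algebra.TensorProduct.assoc K K K H H H
        (Algebra.TensorProduct.map (Bialgebra.comulAlgHom K H) (AlgHom.id K H)
            (↑J.val⁻¹ : H ⊗[K] H) * ((↑J.val⁻¹ : H ⊗[K] H) ⊗ₜ[K] (1 : H))) := by
  have h := J.cocycle
  refine left_inv_eq_right_inv (a := (1 ⊗ₜ[K] (J.val : H ⊗[K] H)) *
        Algebra.TensorProduct.map (AlgHom.id K H) (Bialgebra.comulAlgHom K H) (J.val : H ⊗[K] H))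
        ?_ ?_
  · rw [mul_assoc, ← mul_assoc (1 ⊗ₜ[K] _)]
    simp only [Algebra.TensorProduct.tmul_mul_tmul, Units.inv_mul, mul_one,
      ← Algebra.TensorProduct.one_def, one_mul, ← map_mul, map_one]
  · rw [h, ← map_mul, mul_assoc, ← mul_assoc (Algebra.TensorProduct.map _ _ _), ← map_mul]
    simp only [Algebra.TensorProduct.tmul_mul_tmul, Units.mul_inv, mul_one, map_one,
      ← Algebra.TensorProduct.one_def, one_mul]

lemma comulTw_coassoc :
    (Algebra.TensorProduct.assoc K K K H H H).toAlgHom.comp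
      ((Algebra.TensorProduct.map J.comulTw (.id K H)).comp J.comulTw)
      = (Algebra.TensorProduct.map (.id K H) J.comulTw).comp J.comulTw := by
  have h1 : ∀ x : H ⊗[K] H, Algebra.TensorProduct.map J.comulTw (.id K H) x =
      ((J.val : H ⊗[K] H) ⊗ₜ[K] (1 : H)) *
        Algebra.TensorProduct.map (Bialgebra.comulAlgHom K H) (AlgHom.id K H) x *
        ((↑J.val⁻¹ : H ⊗[K] H) ⊗ₜ[K] (1 : H)) := by
    intro x
    induction x with
    | zero => simp
    | tmul a b => simp [comulTw_apply]
    | add a b ha hb => simp only [map_add, ha, hb, mul_add, add_mul]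
  have h2 : ∀ x : H ⊗[K] H, Algebra.TensorProduct.map (.id K H) J.comulTw x =
      ((1 : H) ⊗ₜ[K] (J.val : H ⊗[K] H)) *
        Algebra.TensorProduct.map (AlgHom.id K H) (Bialgebra.comulAlgHom K H) x *
        ((1 : H) ⊗ₜ[K] (↑J.val⁻¹ : H ⊗[K] H)) := by
    intro x
    induction x with
    | zero => simp
    | tmul a b => simp [comulTw_apply]
    | add a b ha hb => simp only [map_add, ha, hb, mul_add, add_mul]
  ext a
  have h3 : Algebra.TensorProduct.assoc K K K H H H
      (Algebra.TensorProduct.map (Bialgebra.comulAlgHom K H) (AlgHom.id K H)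
        (Coalgebra.comul a)) =
      Algebra.TensorProduct.map (AlgHom.id K H) (Bialgebra.comulAlgHom K H)
        (Coalgebra.comul a) := Coalgebra.coassoc_apply a
  change Algebra.TensorProduct.assoc K K K H H H
    (Algebra.TensorProduct.map J.comulTw (.id K H) (J.comulTw a)) =
    Algebra.TensorProduct.map (.id K H) J.comulTw (J.comulTw a)
  rw [h1, h2, comulTw_apply]
  simp only [map_mul (Algebra.TensorProduct.map (Bialgebra.comulAlgHom K H) (AlgHom.id K H)),
    map_mul (Algebra.TensorProduct.map (AlgHom.id K H) (Bialgebra.comulAlgHom K H))]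
  rw [← h3]
  have c1 := J.cocycle
  have c2 := J.cocycle_inv
  rw [map_mul] at c1 c2
  simp only [map_mul, mul_assoc] at c1 c2 ⊢
  rw [c2, ← mul_assoc (1 ⊗ₜ[K] _), c1]
  simp only [mul_assoc]

lemma counit_left_comulTw :
    (Algebra.TensorProduct.map (Bialgebra.counitAlgHom K H) (.id K H)).comp J.comulTw
      = (Algebra.TensorProduct.lid K H).symm := by
  ext a
  apply (Algebra.TensorProduct.lid K H).injective
  change Algebra.TensorProduct.lid K H
    (Algebra.TensorProduct.map (Bialgebra.counitAlgHom K H) (.id K H) (J.comulTw a)) =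
    Algebra.TensorProduct.lid K H ((Algebra.TensorProduct.lid K H).symm a)
  have h3 : Algebra.TensorProduct.lid K H
      (Algebra.TensorProduct.map (Bialgebra.counitAlgHom K H) (.id K H) (Coalgebra.comul a)) = a := by
    have := Coalgebra.rTensor_counit_comul (R := K) a
    change Algebra.TensorProduct.lid K H (Coalgebra.counit.rTensor H (Coalgebra.comul a)) = a
    rw [this]; simp
  have h4 : Algebra.TensorProduct.lid K H
      (Algebra.TensorProduct.map (Bialgebra.counitAlgHom K H) (.id K H) (↑J.val⁻¹)) = 1 := by
    have := congrArg (fun x => Algebra.TensorProduct.lid K H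
      (Algebra.TensorProduct.map (Bialgebra.counitAlgHom K H) (.id K H) x)) J.val.mul_inv
    simpa only [map_mul, J.counit_left, one_mul, map_one] using this
  rw [comulTw_apply, map_mul, map_mul, map_mul, map_mul, h3, h4, J.counit_left]
  simp

lemma counit_right_comulTw :
    (Algebra.TensorProduct.map (.id K H) (Bialgebra.counitAlgHom K H)).comp J.comulTw
      = (Algebra.TensorProduct.rid K K H).symm := by
  ext a
  apply (Algebra.TensorProduct.rid K K H).injective
  change Algebra.TensorProduct.rid K K H
    (Algebra.TensorProduct.map (.id K H) (Bialgebra.counitAlgHom K H) (J.comulTw a)) =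
    Algebra.TensorProduct.rid K K H ((Algebra.TensorProduct.rid K K H).symm a)
  have h3 : Algebra.TensorProduct.rid K K H
      (Algebra.TensorProduct.map (.id K H) (Bialgebra.counitAlgHom K H) (Coalgebra.comul a)) = a := by
    have := Coalgebra.lTensor_counit_comul (R := K) a
    change Algebra.TensorProduct.rid K K H (Coalgebra.counit.lTensor H (Coalgebra.comul a)) = a
    rw [this]; simp
  have h4 : Algebra.TensorProduct.rid K K H
      (Algebra.TensorProduct.map (.id K H) (Bialgebra.counitAlgHom K H) (↑J.val⁻¹)) = 1 := by
    have := congrArg (fun x => Algebra.TensorProduct.rid K K H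
      (Algebra.TensorProduct.map (.id K H) (Bialgebra.counitAlgHom K H) x)) J.val.mul_inv
    simpa only [map_mul, J.counit_right, one_mul, map_one] using this
  rw [comulTw_apply, map_mul, map_mul, map_mul, map_mul, h3, h4, J.counit_right]
  simp

/-- `a ⊗ b ↦ a c S(b)`. -/
noncomputable def sandR (c : H) : H ⊗[K] H →ₗ[K] H :=
  LinearMap.mul' K H ∘ₗ TensorProduct.map (LinearMap.mulRight K c) (HopfAlgebra.antipode K)

/-- `a ⊗ b ↦ S(a) c b`. -/
noncomputable def sandL (c : H) : H ⊗[K] H →ₗ[K] H :=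
  LinearMap.mul' K H ∘ₗ TensorProduct.map (LinearMap.mulRight K c ∘ₗ HopfAlgebra.antipode K) .id

@[simp] lemma sandR_tmul (c a b : H) :
    sandR (K := K) c (a ⊗ₜ b) = a * c * HopfAlgebra.antipode K b := rfl

@[simp] lemma sandL_tmul (c a b : H) :
    sandL (K := K) c (a ⊗ₜ b) = HopfAlgebra.antipode K a * c * b := rfl

lemma sandR_mul (c : H) (x y : H ⊗[K] H) : sandR c (x * y) = sandR (sandR c y) x := by
  induction x with
  | zero => simp
  | add a b ha hb => simp only [add_mul, map_add, ha, hb]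
  | tmul a b =>
    induction y with
    | zero => simp
    | add a b ha hb => simp only [mul_add, map_add, ha, hb, sandR_tmul, add_mul] at *
    | tmul a' b' => simp [HopfAlgebra.antipode_mul_antidistrib, mul_assoc]

lemma sandL_mul (c : H) (x y : H ⊗[K] H) : sandL c (x * y) = sandL (sandL c x) y := by
  induction y with
  | zero => simp
  | add a b ha hb => simp only [mul_add, map_add, ha, hb]
  | tmul a b =>
    induction x with
    | zero => simp
    | add a b ha hb => simp only [mul_add, add_mul, map_add, ha, hb, sandL_tmul] at *
    | tmul a' b' => simp [HopfAlgebra.antipode_mul_antidistrib, mul_assoc]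

lemma U_eq : J.U = sandR 1 (J.val : H ⊗[K] H) := by
  unfold U
  induction (J.val : H ⊗[K] H) with
  | zero => simp
  | add a b ha hb => simp only [map_add, ha, hb]
  | tmul a b => simp

lemma Uinv_eq : J.Uinv = sandL 1 (↑J.val⁻¹ : H ⊗[K] H) := by
  unfold Uinv
  induction (↑J.val⁻¹ : H ⊗[K] H) with
  | zero => simp
  | add a b ha hb => simp only [map_add, ha, hb]
  | tmul a b => simp

lemma sandR_one_comul (h : H) :
    sandR 1 (Coalgebra.comul (R := K) h) = algebraMap K H (Coalgebra.counit h) := by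
  rw [← HopfAlgebra.mul_antipode_lTensor_comul_apply]
  induction (Coalgebra.comul (R := K) h) with
  | zero => simp
  | add a b ha hb => simp only [map_add, ha, hb]
  | tmul a b => simp

lemma sandL_one_comul (h : H) :
    sandL 1 (Coalgebra.comul (R := K) h) = algebraMap K H (Coalgebra.counit h) := by
  rw [← HopfAlgebra.mul_antipode_rTensor_comul_apply]
  induction (Coalgebra.comul (R := K) h) with
  | zero => simp
  | add a b ha hb => simp only [map_add, ha, hb]
  | tmul a b => simp

lemma sandR_algebraMap (r : K) (x : H ⊗[K] H) :
    sandR (algebraMap K H r) x = r • sandR 1 x := by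
  induction x with
  | zero => simp
  | add a b ha hb => simp only [map_add, ha, hb, smul_add]
  | tmul a b => simp [Algebra.algebraMap_eq_smul_one]

lemma sandL_algebraMap (r : K) (x : H ⊗[K] H) :
    sandL (algebraMap K H r) x = r • sandL 1 x := by
  induction x with
  | zero => simp
  | add a b ha hb => simp only [map_add, ha, hb, smul_add]
  | tmul a b => simp [Algebra.algebraMap_eq_smul_one]

/-- `a ⊗ b ⊗ c ↦ a S(b) c`. -/
noncomputable def sand3 : H ⊗[K] (H ⊗[K] H) →ₗ[K] H :=
  LinearMap.mul' K H ∘ₗ (sandL (1 : H)).lTensor H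

lemma sand3_left (x : H ⊗[K] H) (z : H ⊗[K] (H ⊗[K] H)) :
    sand3 (K := K) (Algebra.TensorProduct.map (AlgHom.id K H) (Bialgebra.comulAlgHom K H) x * z) =
      Algebra.TensorProduct.rid K K H
        (Algebra.TensorProduct.map (AlgHom.id K H) (Bialgebra.counitAlgHom K H) x) *
        sand3 (K := K) z := by
  induction x with
  | zero => simp
  | add a b ha hb => simp only [map_add, add_mul, ha, hb]
  | tmul a b =>
    induction z with
    | zero => simp
    | add a b ha hb => simp only [map_add, mul_add, ha, hb]
    | tmul c w => simp [sand3, sandL_mul, sandL_one_comul, sandL_algebraMap, mul_assoc]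

lemma sand3_right (x : H ⊗[K] H) (z : (H ⊗[K] H) ⊗[K] H) :
    sand3 (K := K) (Algebra.TensorProduct.assoc K K K H H H
      (z * Algebra.TensorProduct.map (Bialgebra.comulAlgHom K H) (AlgHom.id K H) x)) =
      sand3 (K := K) (Algebra.TensorProduct.assoc K K K H H H z) *
      Algebra.TensorProduct.lid K H
        (Algebra.TensorProduct.map (Bialgebra.counitAlgHom K H) (AlgHom.id K H) x) := by
  have key : ∀ (u : H ⊗[K] H) (c : H), sand3 (K := K) (Algebra.TensorProduct.assoc K K K H H H
      (u ⊗ₜ[K] c)) = sandR 1 u * c := by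
    intro u c
    induction u with
    | zero => simp
    | add a b ha hb => simp only [map_add, TensorProduct.add_tmul, ha, hb, add_mul]
    | tmul a b => simp [sand3, mul_assoc]
  induction x with
  | zero => simp
  | add a b ha hb => simp only [map_add, mul_add, ha, hb]
  | tmul a b =>
    induction z with
    | zero => simp
    | add a b ha hb => simp only [map_add, add_mul, ha, hb]
    | tmul w c =>
      rw [Algebra.TensorProduct.map_tmul, Algebra.TensorProduct.tmul_mul_tmul, key, key, sandR_mul]
      simp [sandR_one_comul, sandR_algebraMap, mul_assoc]

lemma U_mul_Uinv : J.U * J.Uinv = 1 := by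
  set Δr := Algebra.TensorProduct.map (AlgHom.id K H) (Bialgebra.comulAlgHom K H) with hΔr
  set Δl := Algebra.TensorProduct.map (Bialgebra.comulAlgHom K H) (AlgHom.id K H) with hΔl
  set α := Algebra.TensorProduct.assoc K K K H H H with hα
  have h := J.cocycle
  -- `(id ⊗ Δ)(J) (Δ ⊗ id)(J⁻¹) = (1 ⊗ J⁻¹)(J ⊗ 1)`
  have e : Δr (J.val : H ⊗[K] H) * α (Δl (↑J.val⁻¹ : H ⊗[K] H)) =
      ((1 : H) ⊗ₜ[K] (↑J.val⁻¹ : H ⊗[K] H)) * α ((J.val : H ⊗[K] H) ⊗ₜ[K] (1 : H)) := by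
    have h1 : ((1 : H) ⊗ₜ[K] (↑J.val⁻¹ : H ⊗[K] H)) * ((1 : H) ⊗ₜ[K] (J.val : H ⊗[K] H)) = 1 := by
      simp [Algebra.TensorProduct.one_def]
    have h2 : α (Δl (J.val : H ⊗[K] H)) * α (Δl (↑J.val⁻¹ : H ⊗[K] H)) = 1 := by
      rw [← map_mul, ← map_mul]; simp
    calc _ = (((1 : H) ⊗ₜ[K] (↑J.val⁻¹ : H ⊗[K] H)) * ((1 : H) ⊗ₜ[K] (J.val : H ⊗[K] H))) *
          Δr (J.val : H ⊗[K] H) * α (Δl (↑J.val⁻¹ : H ⊗[K] H)) := by rw [h1, one_mul]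
      _ = _ := by
        rw [mul_assoc, mul_assoc, ← mul_assoc _ (Δr _), h, map_mul, mul_assoc, h2, mul_one]
  have hl : Algebra.TensorProduct.lid K H
      (Algebra.TensorProduct.map (Bialgebra.counitAlgHom K H) (.id K H) (↑J.val⁻¹)) = 1 := by
    have := congrArg (fun x => Algebra.TensorProduct.lid K H
      (Algebra.TensorProduct.map (Bialgebra.counitAlgHom K H) (.id K H) x)) J.val.mul_inv
    simpa only [map_mul, J.counit_left, one_mul, map_one] using this
  have e1 : sand3 (K := K) (Δr (J.val : H ⊗[K] H) * α (Δl (↑J.val⁻¹ : H ⊗[K] H))) = 1 := by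
    rw [sand3_left, J.counit_right, one_mul]
    have := sand3_right (K := K) (↑J.val⁻¹ : H ⊗[K] H) 1
    rw [one_mul, hl, mul_one] at this
    rw [this]
    simp [sand3, Algebra.TensorProduct.one_def]
  rw [e] at e1
  rw [← e1, U_eq, Uinv_eq]
  induction (↑J.val⁻¹ : H ⊗[K] H) with
  | zero => simp
  | add a b ha hb => simp only [map_add, TensorProduct.tmul_add, add_mul, mul_add, ha, hb]
  | tmul a b =>
    induction (J.val : H ⊗[K] H) with
    | zero => simp
    | add a b ha hb => simp only [map_add, TensorProduct.add_tmul, add_mul, mul_add, ha, hb]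
    | tmul c d => simp [sand3, hα, HopfAlgebra.antipode_mul_antidistrib, mul_assoc]

noncomputable instance : Coalgebra K J.Twisted where
  comul := (J.comulTw.toLinearMap : H →ₗ[K] H ⊗[K] H)
  counit := (Coalgebra.counit : H →ₗ[K] K)
  coassoc := congrArg AlgHom.toLinearMap J.comulTw_coassoc
  rTensor_counit_comp_comul := congrArg AlgHom.toLinearMap J.counit_left_comulTw
  lTensor_counit_comp_comul := congrArg AlgHom.toLinearMap J.counit_right_comulTw

noncomputable instance : Bialgebra K J.Twisted where
  counit_one := Bialgebra.counit_one (R := K) (A := H)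
  mul_compr₂_counit := Bialgebra.mul_compr₂_counit (R := K) (A := H)
  comul_one := map_one J.comulTw
  mul_compr₂_comul := LinearMap.ext fun a => LinearMap.ext fun b => map_mul J.comulTw a b

lemma mul_antipodeTw_rTensor (h : H) :
    LinearMap.mul' K H (J.antipodeTw.rTensor H (J.comulTw h)) =
      algebraMap K H (Coalgebra.counit h) := by
  have h1 : ∀ x : H ⊗[K] H, LinearMap.mul' K H (J.antipodeTw.rTensor H x) =
      J.U * sandL J.Uinv x := by
    intro x
    induction x with
    | zero => simp
    | add a b ha hb => simp only [map_add, ha, hb, mul_add]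
    | tmul a b => simp [antipodeTw_apply, mul_assoc]
  rw [h1, comulTw_apply, sandL_mul, sandL_mul, Uinv_eq, ← sandL_mul 1 (↑J.val⁻¹) (J.val : H ⊗[K] H),
    Units.inv_mul]
  have h2 : sandL (K := K) (1 : H) 1 = 1 := by simp [Algebra.TensorProduct.one_def]
  rw [h2, sandL_one_comul, sandL_algebraMap, ← Uinv_eq, mul_smul_comm, U_mul_Uinv,
    Algebra.algebraMap_eq_smul_one]

lemma mul_antipodeTw_lTensor (h : H) :
    LinearMap.mul' K H (J.antipodeTw.lTensor H (J.comulTw h)) =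
      algebraMap K H (Coalgebra.counit h) := by
  have h1 : ∀ x : H ⊗[K] H, LinearMap.mul' K H (J.antipodeTw.lTensor H x) =
      sandR J.U x * J.Uinv := by
    intro x
    induction x with
    | zero => simp
    | add a b ha hb => simp only [map_add, ha, hb, add_mul]
    | tmul a b => simp [antipodeTw_apply, mul_assoc]
  rw [h1, comulTw_apply, sandR_mul, U_eq, ← sandR_mul 1 (↑J.val⁻¹) (J.val : H ⊗[K] H),
    Units.inv_mul, sandR_mul]
  have h2 : sandR (K := K) (1 : H) 1 = 1 := by simp [Algebra.TensorProduct.one_def]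
  rw [h2, sandR_one_comul, sandR_algebraMap, ← U_eq, smul_mul_assoc, U_mul_Uinv,
    Algebra.algebraMap_eq_smul_one]

/-- The Drinfeld twist `H_J` of `H`: the algebra `H` with coproduct `Δ_J(h) = J Δ(h) J⁻¹`,
the counit of `H`, and antipode `S_J(h) = U_J S(h) U_J⁻¹`. -/
noncomputable instance : HopfAlgebra K J.Twisted where
  antipode := (J.antipodeTw : H →ₗ[K] H)
  mul_antipode_rTensor_comul := LinearMap.ext J.mul_antipodeTw_rTensor
  mul_antipode_lTensor_comul := LinearMap.ext J.mul_antipodeTw_lTensor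

/-- `Δ_J(h) = J Δ(h) J⁻¹`, as an identity in `H_J ⊗ H_J`. -/
lemma comul_toTwisted (h : H) :
    Coalgebra.comul (R := K) (J.toTwisted h) =
      TensorProduct.map J.toTwisted.toLinearMap J.toTwisted.toLinearMap
        ((J.val : H ⊗[K] H) * Coalgebra.comul h * (↑J.val⁻¹ : H ⊗[K] H)) := by
  erw [TensorProduct.map_id]
  rfl

lemma counit_toTwisted (h : H) :
    Coalgebra.counit (R := K) (J.toTwisted h) = Coalgebra.counit (R := K) h := rfl

lemma antipode_toTwisted (h : H) :
    HopfAlgebra.antipode K (J.toTwisted h) =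
      J.toTwisted (J.U * HopfAlgebra.antipode K h * J.Uinv) := rfl

end

end DrinfeldTwist

section GroupAlgebra

attribute [local instance] Fintype.ofFinite

/-- `(1/|A|) ∑_{a ∈ A} φ(a⁻¹) i(a) ∈ KG`. For `i` injective and `A` abelian this is the primitive
idempotent `e_φ` of the group algebra of `A`, viewed inside `KG` through `i`. -/
noncomputable def charIdem {K A G : Type*} [Field K] [Group A] [Finite A] [Group G]
    (i : A →* G) (φ : A →* Kˣ) : MonoidAlgebra K G :=
  (Nat.card A : K)⁻¹ • ∑ a : A, MonoidAlgebra.single (i a) ((φ a⁻¹ : Kˣ) : K)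

instance finite_characters {K A : Type*} [Field K] [Group A] [Finite A] : Finite (A →* Kˣ) := by
  have : NeZero (Monoid.exponent A) := ⟨Monoid.exponent_ne_zero_of_finite⟩
  refine Finite.of_injective
    (β := A → rootsOfUnity (Monoid.exponent A) K)
    (fun φ a => ⟨φ a, by
      rw [mem_rootsOfUnity, ← map_pow, Monoid.pow_exponent_eq_one, map_one]⟩) ?_
  intro φ ψ h
  ext a
  simpa using congrArg (fun x => ((x a : Kˣ) : K)) h

/-- A normalized `2`-cocycle on the group `A` with values in `Kˣ` (trivial action). -/
structure IsNormalizedTwoCocycle {K A : Type*} [Field K] [Group A] (ω : A → A → Kˣ) :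
    Prop where
  cocycle : ∀ a b c, ω a b * ω (a * b) c = ω b c * ω a (b * c)
  one_left : ∀ a, ω 1 a = 1
  one_right : ∀ a, ω a 1 = 1

lemma single_sum_aux {K G ι : Type*} [Field K] (s : Finset ι) (g : G) (c : ι → K) :
    MonoidAlgebra.single g (∑ j ∈ s, c j) = ∑ j ∈ s, MonoidAlgebra.single g (c j) :=
  map_sum (MonoidAlgebra.lsingle (R := K) g) c s

section CharIdem

variable {K A G : Type*} [Field K] [Group A] [Finite A] [Group G] (i : A →* G)

lemma single_mul_charIdem (a : A) (φ : A →* Kˣ) :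
    MonoidAlgebra.single (i a) (1 : K) * charIdem i φ = ((φ a : Kˣ) : K) • charIdem i φ := by
  unfold charIdem
  rw [mul_smul_comm, smul_comm, Finset.mul_sum]
  congr 1
  rw [Finset.smul_sum]
  refine Fintype.sum_equiv (Equiv.mulLeft a) _ _ fun b => ?_
  have h : ((φ b⁻¹ : Kˣ) : K) = ((φ a * φ (a * b)⁻¹ : Kˣ) : K) := by
    rw [← map_mul]; simp
  simp only [MonoidAlgebra.single_mul_single, MonoidAlgebra.smul_single, one_mul, smul_eq_mul,
    Equiv.coe_mulLeft, map_mul i, ← Units.val_mul, h]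

lemma charIdem_mul [CharZero K] (φ ψ : A →* Kˣ) [Decidable (φ = ψ)] :
    charIdem (K := K) i φ * charIdem i ψ = if φ = ψ then charIdem i φ else 0 := by
  classical
  have h1 : charIdem (K := K) i φ * charIdem i ψ =
      ((Nat.card A : K)⁻¹ * ∑ a : A, (((φ⁻¹ * ψ) a : Kˣ) : K)) • charIdem i ψ := by
    conv_lhs => rw [charIdem]
    rw [smul_mul_assoc, Finset.sum_mul, mul_smul, Finset.sum_smul]
    congr 1
    refine Finset.sum_congr rfl fun a _ => ?_
    have : (MonoidAlgebra.single (i a) ((φ a⁻¹ : Kˣ) : K)) =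
        ((φ a⁻¹ : Kˣ) : K) • MonoidAlgebra.single (i a) (1 : K) := by
      simp [MonoidAlgebra.smul_single]
    rw [this, smul_mul_assoc, single_mul_charIdem, smul_smul]
    simp
  rw [h1]
  split_ifs with h
  · subst h
    have : (Nat.card A : K) ≠ 0 := by exact_mod_cast Nat.card_pos.ne'
    simp [← Nat.card_eq_fintype_card, this]
  · have h3 := sum_hom_units_eq_zero (R := K) ((Units.coeHom K).comp (φ⁻¹ * ψ)) (by
      intro h0
      apply h
      ext a
      have h4 := DFunLike.congr_fun h0 a
      simp only [MonoidHom.comp_apply, Units.coeHom_apply, MonoidHom.one_apply,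
        Units.val_eq_one, MonoidHom.mul_apply, MonoidHom.inv_apply] at h4
      rw [inv_mul_eq_one.mp h4])
    simp only [MonoidHom.comp_apply, Units.coeHom_apply] at h3
    rw [h3, mul_zero, zero_smul]

lemma counit_charIdem [CharZero K] (φ : A →* Kˣ) [Decidable (φ = 1)] :
    Coalgebra.counit (R := K) (charIdem (K := K) i φ) = if φ = 1 then 1 else 0 := by
  unfold charIdem
  rw [map_smul, map_sum]
  simp only [MonoidAlgebra.counit_single, CommSemiring.counit_apply]
  split_ifs with h
  · subst h
    have : (Nat.card A : K) ≠ 0 := by exact_mod_cast Nat.card_pos.ne'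
    simp [← Nat.card_eq_fintype_card, this]
  · have h3 := sum_hom_units_eq_zero (R := K) ((Units.coeHom K).comp φ⁻¹) (by
      intro h0
      apply h
      ext a
      have h4 := DFunLike.congr_fun h0 a
      simpa using h4)
    simp only [MonoidHom.comp_apply, Units.coeHom_apply, MonoidHom.inv_apply] at h3
    simp only [map_inv, h3, smul_zero]

lemma sum_char_smul_charIdem [CharZero K] [IsMulCommutative A]
    [HasEnoughRootsOfUnity K (Monoid.exponent A)] (a : A) :
    ∑ φ : A →* Kˣ, ((φ a : Kˣ) : K) • charIdem (K := K) i φ = MonoidAlgebra.single (i a) 1 := by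
  classical
  let _ : CommGroup A := { ‹Group A› with mul_comm := mul_comm' }
  have hc : (Nat.card A : K) ≠ 0 := by exact_mod_cast Nat.card_pos.ne'
  have h1 : ∀ b : A, ∑ φ : A →* Kˣ, ((φ a : Kˣ) : K) * ((φ b⁻¹ : Kˣ) : K) =
      if b = a then (Nat.card A : K) else 0 := by
    intro b
    split_ifs with h
    · subst h
      rw [← CommGroup.card_monoidHom_of_hasEnoughRootsOfUnity A K]
      simp
    · obtain ⟨ψ, hψ⟩ := CommGroup.exists_apply_ne_one_of_hasEnoughRootsOfUnity A K
        (a := a * b⁻¹) (by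
          intro h0
          exact h (mul_inv_eq_one.mp h0).symm)
      have h3 := sum_hom_units_eq_zero (R := K)
        ((Units.coeHom K).comp (MonoidHom.eval (a * b⁻¹) : (A →* Kˣ) →* Kˣ)) (by
          intro h0
          apply hψ
          have h4 := DFunLike.congr_fun h0 ψ
          apply Units.ext
          simpa using h4)
      simpa using h3
  unfold charIdem
  simp_rw [Finset.smul_sum]
  rw [Finset.sum_comm, Finset.sum_eq_single a]
  · simp only [MonoidAlgebra.smul_single, smul_eq_mul]
    simp_rw [mul_left_comm _ (Nat.card A : K)⁻¹]
    rw [← single_sum_aux, ← Finset.mul_sum, h1, if_pos rfl, inv_mul_cancel₀ hc]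
  · intro b _ hb
    simp only [MonoidAlgebra.smul_single, smul_eq_mul]
    simp_rw [mul_left_comm _ (Nat.card A : K)⁻¹]
    rw [← single_sum_aux, ← Finset.mul_sum, h1, if_neg hb, mul_zero,
      MonoidAlgebra.single_zero]
  · simp

lemma sum_charIdem [CharZero K] [IsMulCommutative A]
    [HasEnoughRootsOfUnity K (Monoid.exponent A)] :
    ∑ φ : A →* Kˣ, charIdem (K := K) i φ = 1 := by
  have := sum_char_smul_charIdem (K := K) i 1
  simpa [MonoidAlgebra.one_def] using this

lemma comul_charIdem [CharZero K] [IsMulCommutative A]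
    [HasEnoughRootsOfUnity K (Monoid.exponent A)] (φ : A →* Kˣ) :
    Coalgebra.comul (R := K) (charIdem (K := K) i φ) =
      ∑ η : A →* Kˣ, charIdem i η ⊗ₜ[K] charIdem i (η⁻¹ * φ) := by
  have h1 : ∀ η : A →* Kˣ, charIdem (K := K) i η ⊗ₜ[K] charIdem (K := K) i (η⁻¹ * φ) =
      (Nat.card A : K)⁻¹ • ∑ a : A, (((φ a⁻¹ : Kˣ) : K) * ((η a : Kˣ) : K)) •
        (charIdem (K := K) i η ⊗ₜ[K] MonoidAlgebra.single (i a) (1 : K)) := by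
    intro η
    conv_lhs => rw [charIdem.eq_1 i (η⁻¹ * φ)]
    rw [TensorProduct.tmul_smul, TensorProduct.tmul_sum]
    congr 1
    refine Finset.sum_congr rfl fun a _ => ?_
    rw [← TensorProduct.tmul_smul, MonoidAlgebra.smul_single]
    congr 2
    simp [mul_comm]
  simp_rw [h1]
  rw [← Finset.smul_sum, Finset.sum_comm]
  conv_lhs => rw [charIdem]
  rw [map_smul, map_sum]
  congr 1
  refine Finset.sum_congr rfl fun a _ => ?_
  simp_rw [mul_smul, ← Finset.smul_sum]
  simp_rw [TensorProduct.smul_tmul', ← TensorProduct.sum_tmul]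
  rw [sum_char_smul_charIdem (K := K) i a, MonoidAlgebra.comul_single,
    CommSemiring.comul_apply, TensorProduct.map_tmul]
  have h2 : ∀ r : K, MonoidAlgebra.single (i a) r = r • MonoidAlgebra.single (i a) (1 : K) := by
    intro r; simp [MonoidAlgebra.smul_single]
  simp only [MonoidAlgebra.lsingle_apply]
  rw [h2 ((φ a⁻¹ : Kˣ) : K)]
  exact (TensorProduct.smul_tmul _ _ _).symm

/-- `∑ c(φ,ψ) e_φ ⊗ e_ψ` -/
noncomputable def idemSum (c : (A →* Kˣ) → (A →* Kˣ) → K) :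
    MonoidAlgebra K G ⊗[K] MonoidAlgebra K G :=
  ∑ φ : A →* Kˣ, ∑ ψ : A →* Kˣ, c φ ψ • (charIdem i φ ⊗ₜ[K] charIdem i ψ)

lemma idemSum_mul [CharZero K] (c d : (A →* Kˣ) → (A →* Kˣ) → K) :
    idemSum i c * idemSum i d = idemSum i (fun φ ψ => c φ ψ * d φ ψ) := by
  classical
  unfold idemSum
  simp_rw [Finset.sum_mul, Finset.mul_sum, smul_mul_smul_comm,
    Algebra.TensorProduct.tmul_mul_tmul, charIdem_mul]
  refine Finset.sum_congr rfl fun φ _ => Finset.sum_congr rfl fun ψ _ => ?_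
  rw [Finset.sum_eq_single φ, Finset.sum_eq_single ψ]
  · simp
  · intro b _ hb; simp [hb.symm]
  · simp
  · intro b _ hb
    refine Finset.sum_eq_zero fun x _ => ?_
    simp [hb.symm]
  · simp

lemma idemSum_one [CharZero K] [IsMulCommutative A]
    [HasEnoughRootsOfUnity K (Monoid.exponent A)] :
    idemSum (K := K) i (fun _ _ => 1) = 1 := by
  unfold idemSum
  simp_rw [one_smul, ← TensorProduct.tmul_sum, ← TensorProduct.sum_tmul, sum_charIdem]
  rfl

/-- `∑ c(φ,ψ,χ) e_φ ⊗ e_ψ ⊗ e_χ` -/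
noncomputable def idemSum3 (c : (A →* Kˣ) → (A →* Kˣ) → (A →* Kˣ) → K) :
    MonoidAlgebra K G ⊗[K] (MonoidAlgebra K G ⊗[K] MonoidAlgebra K G) :=
  ∑ φ : A →* Kˣ, ∑ ψ : A →* Kˣ, ∑ χ : A →* Kˣ,
    c φ ψ χ • (charIdem i φ ⊗ₜ[K] (charIdem i ψ ⊗ₜ[K] charIdem i χ))

lemma sum_tmul_mul_aux {ι B C : Type*} [Fintype ι] [DecidableEq ι] [Ring B] [Ring C] [Algebra K B]
    [Algebra K C] (e : ι → B) (he : ∀ a b, e a * e b = if a = b then e a else 0) (x y : ι → C) :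
    (∑ a, e a ⊗ₜ[K] x a) * (∑ a, e a ⊗ₜ[K] y a) = ∑ a, e a ⊗ₜ[K] (x a * y a) := by
  simp_rw [Finset.sum_mul, Finset.mul_sum, Algebra.TensorProduct.tmul_mul_tmul, he]
  refine Finset.sum_congr rfl fun a _ => ?_
  rw [Finset.sum_eq_single a]
  · simp
  · intro b _ hb; simp [hb.symm]
  · simp

lemma idemSum3_eq (c : (A →* Kˣ) → (A →* Kˣ) → (A →* Kˣ) → K) :
    idemSum3 i c = ∑ φ : A →* Kˣ, charIdem i φ ⊗ₜ[K] idemSum i (c φ) := by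
  unfold idemSum3 idemSum
  simp_rw [TensorProduct.tmul_sum, TensorProduct.tmul_smul]

lemma idemSum3_mul [CharZero K] (c d : (A →* Kˣ) → (A →* Kˣ) → (A →* Kˣ) → K) :
    idemSum3 i c * idemSum3 i d = idemSum3 i (fun φ ψ χ => c φ ψ χ * d φ ψ χ) := by
  classical
  rw [idemSum3_eq, idemSum3_eq, idemSum3_eq,
    sum_tmul_mul_aux _ (fun φ ψ => charIdem_mul i φ ψ)]
  simp_rw [idemSum_mul]

section twist

variable [CharZero K] [IsMulCommutative A] [HasEnoughRootsOfUnity K (Monoid.exponent A)]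
  (c : (A →* Kˣ) → (A →* Kˣ) → K)

lemma one_tmul_idemSum :
    (1 : MonoidAlgebra K G) ⊗ₜ[K] idemSum i c = idemSum3 i (fun _ ψ χ => c ψ χ) := by
  rw [← sum_charIdem (K := K) i]
  unfold idemSum idemSum3
  simp_rw [TensorProduct.sum_tmul, TensorProduct.tmul_sum, TensorProduct.tmul_smul]

lemma idemSum_tmul_one :
    Algebra.TensorProduct.assoc K K K _ _ _ (idemSum i c ⊗ₜ[K] (1 : MonoidAlgebra K G)) =
      idemSum3 i (fun φ ψ _ => c φ ψ) := by
  rw [← sum_charIdem (K := K) i]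
  unfold idemSum idemSum3
  simp_rw [TensorProduct.sum_tmul, TensorProduct.tmul_sum, map_sum, ← TensorProduct.smul_tmul',
    map_smul, Algebra.TensorProduct.assoc_tmul]

lemma id_comul_idemSum :
    Algebra.TensorProduct.map (AlgHom.id K _) (Bialgebra.comulAlgHom K _) (idemSum i c) =
      idemSum3 i (fun φ ψ χ => c φ (ψ * χ)) := by
  unfold idemSum idemSum3
  simp_rw [map_sum, map_smul, Algebra.TensorProduct.map_tmul, Bialgebra.comulAlgHom_apply,
    comul_charIdem, TensorProduct.tmul_sum, Finset.smul_sum]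
  refine Finset.sum_congr rfl fun φ _ => ?_
  rw [Finset.sum_comm]
  refine Finset.sum_congr rfl fun ψ _ => ?_
  refine Fintype.sum_equiv (Equiv.mulLeft ψ⁻¹) _ _ fun χ => ?_
  have h : ψ * (ψ⁻¹ * χ) = χ := by ext; simp
  simp [h]

lemma comul_id_idemSum :
    Algebra.TensorProduct.assoc K K K _ _ _
      (Algebra.TensorProduct.map (Bialgebra.comulAlgHom K _) (AlgHom.id K _) (idemSum i c)) =
      idemSum3 i (fun φ ψ χ => c (φ * ψ) χ) := by
  unfold idemSum idemSum3
  simp_rw [map_sum, map_smul, Algebra.TensorProduct.map_tmul, Bialgebra.comulAlgHom_apply,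
    comul_charIdem, TensorProduct.sum_tmul, map_sum, Finset.smul_sum]
  calc _ = ∑ η : A →* Kˣ, ∑ φ : A →* Kˣ, ∑ χ : A →* Kˣ, c φ χ •
        (charIdem (K := K) i η ⊗ₜ[K] (charIdem (K := K) i (η⁻¹ * φ) ⊗ₜ[K]
          charIdem (K := K) i χ)) := by
        rw [Finset.sum_comm]
        conv_lhs =>
          enter [2, χ]
          rw [Finset.sum_comm]
        rw [Finset.sum_comm]
        refine Finset.sum_congr rfl fun η _ => ?_
        rw [Finset.sum_comm]
        rfl
    _ = _ := by
      refine Finset.sum_congr rfl fun φ _ => ?_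
      refine Fintype.sum_equiv (Equiv.mulLeft φ⁻¹) _ _ fun ψ => ?_
      have h : φ * (φ⁻¹ * ψ) = ψ := by ext; simp
      simp [h]

end twist

end CharIdem

/-- The twist `J_{M,ω} = ∑_{φ,ψ ∈ M̂} ω(φ,ψ) e_φ ⊗ e_ψ` of the group algebra `KG` attached to an
abelian subgroup `M` of `G` (such that `KM` splits) and a normalized `2`-cocycle `ω` on the
character group `M̂ = Hom(M, Kˣ)`. -/
noncomputable def movshevTwist {K G : Type*} [Field K] [CharZero K] [Group G]
    (M : Subgroup G) [Finite M] [IsMulCommutative M]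
    [HasEnoughRootsOfUnity K (Monoid.exponent M)]
    (ω : (M →* Kˣ) → (M →* Kˣ) → Kˣ) (hω : IsNormalizedTwoCocycle ω) :
    DrinfeldTwist K (MonoidAlgebra K G) where
  val :=
    { val := ∑ φ : M →* Kˣ, ∑ ψ : M →* Kˣ,
        (ω φ ψ : K) • (charIdem M.subtype φ ⊗ₜ[K] charIdem M.subtype ψ)
      inv := ∑ φ : M →* Kˣ, ∑ ψ : M →* Kˣ,
        ((ω φ ψ)⁻¹ : K) • (charIdem M.subtype φ ⊗ₜ[K] charIdem M.subtype ψ)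
      val_inv := by
        have := idemSum_mul M.subtype (fun φ ψ => (ω φ ψ : K)) (fun φ ψ => ((ω φ ψ)⁻¹ : K))
        simp only [ne_eq, Units.ne_zero, not_false_eq_true, mul_inv_cancel₀, idemSum_one] at this
        exact this
      inv_val := by
        have := idemSum_mul M.subtype (fun φ ψ => ((ω φ ψ)⁻¹ : K)) (fun φ ψ => (ω φ ψ : K))
        simp only [ne_eq, Units.ne_zero, not_false_eq_true, inv_mul_cancel₀, idemSum_one] at this
        exact this }
  cocycle := by
    change (1 ⊗ₜ[K] idemSum M.subtype (fun φ ψ => (ω φ ψ : K))) *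
      Algebra.TensorProduct.map _ _ (idemSum M.subtype (fun φ ψ => (ω φ ψ : K))) =
      Algebra.TensorProduct.assoc _ _ _ _ _ _
        ((idemSum M.subtype (fun φ ψ => (ω φ ψ : K)) ⊗ₜ[K] 1) *
          Algebra.TensorProduct.map _ _ (idemSum M.subtype (fun φ ψ => (ω φ ψ : K))))
    rw [map_mul, one_tmul_idemSum, idemSum_tmul_one, id_comul_idemSum, comul_id_idemSum,
      idemSum3_mul, idemSum3_mul]
    congr 1
    ext φ ψ χ
    exact_mod_cast congrArg Units.val (hω.cocycle φ ψ χ).symm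
  counit_left := by
    classical
    change Algebra.TensorProduct.lid K _
      (Algebra.TensorProduct.map _ _ (idemSum M.subtype (fun φ ψ => (ω φ ψ : K)))) = 1
    unfold idemSum
    simp_rw [map_sum, map_smul, Algebra.TensorProduct.map_tmul, Bialgebra.counitAlgHom_apply,
      counit_charIdem, Algebra.TensorProduct.lid_tmul]
    rw [Finset.sum_eq_single 1]
    · simp [hω.one_left, sum_charIdem]
    · intro b _ hb; simp [hb]
    · simp
  counit_right := by
    classical
    change Algebra.TensorProduct.rid K K _
      (Algebra.TensorProduct.map _ _ (idemSum M.subtype (fun φ ψ => (ω φ ψ : K)))) = 1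
    unfold idemSum
    simp_rw [map_sum, map_smul, Algebra.TensorProduct.map_tmul, Bialgebra.counitAlgHom_apply,
      counit_charIdem, Algebra.TensorProduct.rid_tmul]
    rw [Finset.sum_comm, Finset.sum_eq_single 1]
    · simp [hω.one_right, sum_charIdem]
    · intro b _ hb; simp [hb]
    · simp

end GroupAlgebra

section HopfOrder

/-- A Hopf order of the Hopf algebra `H` over `R ⊆ K`: a lattice `X` of `H` (a finitely generated
projective `R`-submodule such that the natural map `K ⊗_R X → H` is an isomorphism) that is closed
under the Hopf algebra operations. The image of `X ⊗_R X` in `H ⊗_K H` is the `R`-span of the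
elements `x ⊗ y` with `x, y ∈ X`. -/
structure IsHopfOrder (R K : Type*) {H : Type*} [CommRing R] [Field K] [Algebra R K] [Ring H]
    [HopfAlgebra K H] [Module R H] [IsScalarTower R K H] (X : Submodule R H) : Prop where
  finite : Module.Finite R X
  projective : Module.Projective R X
  isBaseChange : IsBaseChange K X.subtype
  one_mem : (1 : H) ∈ X
  mul_mem : ∀ x ∈ X, ∀ y ∈ X, x * y ∈ X
  comul_mem : ∀ x ∈ X, Coalgebra.comul (R := K) x ∈
    Submodule.span R (Set.image2 (fun a b : H => a ⊗ₜ[K] b) X X)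
  counit_mem : ∀ x ∈ X, Coalgebra.counit (R := K) x ∈ Set.range (algebraMap R K)
  antipode_mem : ∀ x ∈ X, HopfAlgebra.antipode K x ∈ X

end HopfOrder

section Semidirect

variable {K N Q : Type*} [Field K] [CommGroup N] [Group Q] {θ : Q →* MulAut N}

/-- The subgroup `M = LP` of `G = N ⋊ Q` generated by `L ≤ N` and `P ≤ Q`. -/
def subgroupLP (θ : Q →* MulAut N) (L : Subgroup N) (P : Subgroup Q) : Subgroup (N ⋊[θ] Q) :=
  L.map SemidirectProduct.inl ⊔ P.map SemidirectProduct.inr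

/-- The inclusion of `L` in `M = LP`. -/
def inclL (θ : Q →* MulAut N) (L : Subgroup N) (P : Subgroup Q) : L →* subgroupLP θ L P :=
  (SemidirectProduct.inl.comp L.subtype).codRestrict (subgroupLP θ L P) fun l =>
    Subgroup.mem_sup_left (Subgroup.mem_map_of_mem _ l.2)

/-- The inclusion of `P` in `M = LP`. -/
def inclP (θ : Q →* MulAut N) (L : Subgroup N) (P : Subgroup Q) : P →* subgroupLP θ L P :=
  (SemidirectProduct.inr.comp P.subtype).codRestrict (subgroupLP θ L P) fun σ =>
    Subgroup.mem_sup_right (Subgroup.mem_map_of_mem _ σ.2)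

/-- The `2`-cocycle on `M̂` attached to an isomorphism `f : P → L̂`. Writing a character of `M = LP`
as `ρλ`, where `λ` and `ρ` are its restrictions to `L` and `P`, it is
`ω(ρ₁λ₁, ρ₂λ₂) = ρ₂(f⁻¹(λ₁))`. -/
def cocycleOfIso {L : Subgroup N} {P : Subgroup Q} (f : P ≃* (L →* Kˣ))
    (φ ψ : subgroupLP θ L P →* Kˣ) : Kˣ :=
  ψ (inclP θ L P (f.symm (φ.comp (inclL θ L P))))

lemma cocycleOfIso_isNormalizedTwoCocycle {L : Subgroup N} {P : Subgroup Q}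
    (f : P ≃* (L →* Kˣ)) : IsNormalizedTwoCocycle (cocycleOfIso (θ := θ) f) where
  cocycle a b c := by
    simp only [cocycleOfIso]
    rw [show (a * b).comp (inclL θ L P) = a.comp (inclL θ L P) * b.comp (inclL θ L P) from rfl,
      map_mul, map_mul, map_mul]
    change _ = _ * (b _ * c _)
    rw [mul_comm (c _) (c _)]
    exact mul_left_comm _ _ _
  one_left a := by
    have h : f.symm ((1 : subgroupLP θ L P →* Kˣ).comp (inclL θ L P)) = 1 := by
      rw [MonoidHom.one_comp, map_one]
    change a (inclP θ L P _) = 1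
    erw [h]
    simp
  one_right a := rfl

lemma subgroupLP_isMulCommutative {L : Subgroup N} {P : Subgroup Q} [IsMulCommutative P]
    (hLP : ∀ l ∈ L, ∀ σ ∈ P, Commute (SemidirectProduct.inl l : N ⋊[θ] Q)
      (SemidirectProduct.inr σ)) : IsMulCommutative (subgroupLP θ L P) := by
  have hP : ∀ a ∈ P, ∀ b ∈ P, a * b = b * a := fun a ha b hb =>
    congrArg Subtype.val (mul_comm' (⟨a, ha⟩ : P) ⟨b, hb⟩)
  rw [← Subgroup.le_centralizer_iff_isMulCommutative]
  have hPL : P.map (SemidirectProduct.inr : Q →* N ⋊[θ] Q) ≤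
      Subgroup.centralizer (L.map (SemidirectProduct.inl : N →* N ⋊[θ] Q)) := by
    rintro _ ⟨σ, hσ, rfl⟩
    rw [Subgroup.mem_centralizer_iff]
    rintro _ ⟨l, hl, rfl⟩
    exact hLP l hl σ hσ
  have hLL : L.map (SemidirectProduct.inl : N →* N ⋊[θ] Q) ≤
      Subgroup.centralizer (L.map (SemidirectProduct.inl : N →* N ⋊[θ] Q)) := by
    rintro _ ⟨l, hl, rfl⟩
    rw [Subgroup.mem_centralizer_iff]
    rintro _ ⟨l', hl', rfl⟩
    rw [← map_mul, ← map_mul, mul_comm]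
  have hPP : P.map (SemidirectProduct.inr : Q →* N ⋊[θ] Q) ≤
      Subgroup.centralizer (P.map (SemidirectProduct.inr : Q →* N ⋊[θ] Q)) := by
    rintro _ ⟨σ, hσ, rfl⟩
    rw [Subgroup.mem_centralizer_iff]
    rintro _ ⟨σ', hσ', rfl⟩
    rw [← map_mul, ← map_mul, hP _ hσ _ hσ']
  refine sup_le ?_ ?_
  · rw [Subgroup.le_centralizer_iff]
    exact sup_le hLL hPL
  · rw [Subgroup.le_centralizer_iff]
    exact sup_le (Subgroup.le_centralizer_iff.mp hPL) hPP

lemma subgroupLP_pow_exponent {L : Subgroup N} {P : Subgroup Q}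
    [IsMulCommutative (subgroupLP θ L P)] (f : P ≃* (L →* Kˣ)) (x : N ⋊[θ] Q)
    (hx : x ∈ subgroupLP θ L P) : x ^ Monoid.exponent N = 1 := by
  have hcomm : ∀ a ∈ subgroupLP θ L P, ∀ b ∈ subgroupLP θ L P, a * b = b * a := fun a ha b hb =>
    congrArg Subtype.val (mul_comm' (⟨a, ha⟩ : subgroupLP θ L P) ⟨b, hb⟩)
  unfold subgroupLP at hx hcomm
  rw [Subgroup.sup_eq_closure] at hx hcomm
  induction hx using Subgroup.closure_induction with
  | mem x hx =>
    rcases hx with ⟨l, -, rfl⟩ | ⟨σ, hσ, rfl⟩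
    · rw [← map_pow, Monoid.pow_exponent_eq_one, map_one]
    · have h1 : (⟨σ, hσ⟩ : P) ^ Monoid.exponent N = 1 := by
        apply f.injective
        rw [map_pow, map_one]
        ext l
        have h2 : l ^ Monoid.exponent N = 1 := Subtype.ext (Monoid.pow_exponent_eq_one (l : N))
        rw [MonoidHom.pow_apply, ← map_pow, h2, map_one, MonoidHom.one_apply]
      have h3 : σ ^ Monoid.exponent N = 1 := congrArg Subtype.val h1
      rw [← map_pow, h3, map_one]
  | one => exact one_pow _
  | mul x y hx hy h1 h2 =>
    have : Commute x y := hcomm x hx y hy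
    rw [this.mul_pow, h1, h2, one_mul]
  | inv x hx h => rw [inv_pow, h, inv_one]

lemma subgroupLP_hasEnoughRoots [Finite N] {L : Subgroup N} {P : Subgroup Q}
    [IsMulCommutative (subgroupLP θ L P)] [HasEnoughRootsOfUnity K (Monoid.exponent N)]
    (f : P ≃* (L →* Kˣ)) : HasEnoughRootsOfUnity K (Monoid.exponent (subgroupLP θ L P)) := by
  have : NeZero (Monoid.exponent N) := ⟨Monoid.exponent_ne_zero_of_finite⟩
  refine HasEnoughRootsOfUnity.of_dvd K (n := Monoid.exponent N) ?_
  refine Monoid.exponent_dvd_of_forall_pow_eq_one fun x => ?_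
  exact Subtype.ext (subgroupLP_pow_exponent f (x : N ⋊[θ] Q) x.2)

/-- The twist `J` for `K(N ⋊ Q)` arising from an isomorphism `f : P → L̂`, where `L ≤ N` and
`P ≤ Q` are abelian and commute with one another. -/
noncomputable def twistOfIso [CharZero K] [Finite N] [Finite Q] {L : Subgroup N} {P : Subgroup Q}
    [IsMulCommutative P] [HasEnoughRootsOfUnity K (Monoid.exponent N)]
    (hLP : ∀ l ∈ L, ∀ σ ∈ P, Commute (SemidirectProduct.inl l : N ⋊[θ] Q)
      (SemidirectProduct.inr σ)) (f : P ≃* (L →* Kˣ)) :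
    DrinfeldTwist K (MonoidAlgebra K (N ⋊[θ] Q)) :=
  haveI : Finite (N ⋊[θ] Q) := Finite.of_equiv _ SemidirectProduct.equivProd.symm
  haveI := subgroupLP_isMulCommutative hLP
  haveI := subgroupLP_hasEnoughRoots (θ := θ) f
  movshevTwist (subgroupLP θ L P) (cocycleOfIso f) (cocycleOfIso_isNormalizedTwoCocycle f)

/-- The `R`-submodule of `KG`, `G = N ⋊ Q`, underlying the `R`-subalgebra generated by the primitive
idempotents `e_ν`, `ν ∈ N̂`, of `KN` and the elements of `Q`, regarded in the twisted Hopf algebra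
`(KG)_J`. -/
noncomputable def orderNQ [Finite N] (R : Type*) [CommRing R] [Algebra R K]
    (J : DrinfeldTwist K (MonoidAlgebra K (N ⋊[θ] Q))) : Submodule R J.Twisted :=
  Subalgebra.toSubmodule (Algebra.adjoin R (J.toTwisted ''
    (Set.range (fun ν : N →* Kˣ => charIdem SemidirectProduct.inl ν) ∪
      Set.range (fun q : Q => MonoidAlgebra.single (SemidirectProduct.inr q) (1 : K)))))

end Semidirect

/-- The group `N̂^q` of characters of `N` fixed by `q`, for the action
`(q ▹ ν)(n) = ν(q⁻¹ · n)`. -/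
def fixedChars (K : Type*) {N Q : Type*} [Field K] [CommGroup N] [Group Q] (θ : Q →* MulAut N)
    (q : Q) : Subgroup (N →* Kˣ) where
  carrier := {ν | ∀ n, ν (θ q⁻¹ n) = ν n}
  one_mem' := fun _ => rfl
  mul_mem' := fun {a b} ha hb n => by
    rw [MonoidHom.mul_apply, MonoidHom.mul_apply, ha n, hb n]
  inv_mem' := fun {a} ha n => by
    rw [MonoidHom.inv_apply, MonoidHom.inv_apply, ha n]

/-!
Let `X = N̂`, and let `p : X → Q` be the homomorphism `ν ↦ f⁻¹(ν|_L)`. Summing over the characters of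
`P` gives `J = ∑_ν e_ν ⊗ p(ν)`, so on the basis `b(ν, q) = e_ν q` all structure maps of `(KG)_J` are
explicit and have coefficients `0` and `1` (`twistedBasis`). The product is that of the action
groupoid of `Q` on `X`. The coproduct is dual to the composition in a second groupoid with the same
arrows, in which `α` goes from `q` to `p(α) q p(q⁻¹ ▹ α)⁻¹`. These properties are collected in
`BismashBasis`, and the argument takes place in that setting. In particular the `R`-span of the basis
is a Hopf order (`isHopfOrder_span`).

For uniqueness, let `Y` be a Hopf order and `Y^*` the lattice of functionals that are integral on it.
Since `Y` is projective it is the dual of `Y^*`, and traces of integral matrices are integral. So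
characters of modules lie in `Y^*` (`IsHopfOrder.trace_mem_dualLattice`), and characters of comodules
lie in `Y` (`IsHopfOrder.sum_diag_mem`). Three steps show that `Y` is the span of the basis.

* The idempotents `e_ν` lie in `Y` (`BismashBasis.b_one_mem`). The second groupoid acts freely on the
  double coset `O = PτP`, so the character of the corresponding comodule is `∑_{q ∈ O} e_ε q`. Slicing
  its coproduct along the permutation character of `X` gives, up to the term at `ε`, the sum of the
  `e_ν t_ν` over the nontrivial `ν` that are fixed by some `t_ν ∈ O`, and such a `t_ν` is unique. A
  power of this element is the idempotent of the set `T` of all these `ν`. Modulo `L^⊥ = ker p`, the set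
  `T` is a nontrivial subgroup of `L̂` without its identity, so a product of translates of its
  idempotent is the idempotent `e` of a set `A` with `ε ∈ A ⊆ L^⊥`. Because
  `L^⊥ ∩ (q ▹ L^⊥)` is trivial for `q ∈ O`, multiplication by `e` on both sides isolates `e_ε` inside
  the coproduct, and translation gives all `e_ν`.
* `Y` is the direct sum of its intersections with the lines `K e_ν q` (`BismashBasis.coef_smul_mem`).
  The adjoint action of `Y` on the `e_ν` puts the functionals `∑_{q ▹ μ = ν} (e_ε q)^*` in `Y^*`, and
  since the action is faithful their convolution products isolate each `(e_ε q)^*`.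
* The fractional ideals `I(ν, q) = {a | a e_ν q ∈ Y}` are trivial (`BismashBasis.coefIdeal_eq_one`).
  They are submultiplicative for both compositions, and inverse to each other on inverse arrows of
  the second groupoid. Averaging over `X` and over `Q` shows that some power of each of them is
  contained in `R`, and then they all equal `R` because `R` is integrally closed. This is the argument
  that a group of Hopf algebra automorphisms which rescale the basis elements is finite.
-/

/-! ### Integrality of traces and eigenvalues -/

section Integrality

variable {R K : Type*} [CommRing R] [Field K] [Algebra R K]

/-- The trace is a sum of eigenvalues, and each eigenvalue is a root of any polynomial that
annihilates the matrix. -/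
lemma Matrix.isIntegral_trace_of_isIntegral {n : Type*} [Fintype n] [DecidableEq n]
    {M : Matrix n n K} (hM : IsIntegral R M) : IsIntegral R M.trace := by
  let A := AlgebraicClosure K
  let F : Matrix n n K →ₐ[R] Matrix n n A := ((Algebra.ofId K A).mapMatrix).restrictScalars R
  have hF : IsIntegral R (F M) := hM.map F
  rw [← isIntegral_algebraMap_iff (algebraMap K A).injective]
  have htr : algebraMap K A M.trace = (F M).trace := by
    simp [F, Matrix.trace, Algebra.ofId_apply]
  rw [htr, Matrix.trace_eq_sum_roots_charpoly]
  refine IsIntegral.multiset_sum fun μ hμ => ?_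
  have hμ' : μ ∈ spectrum A (F M) :=
    Matrix.mem_spectrum_iff_isRoot_charpoly.mpr (Polynomial.isRoot_of_mem_roots hμ)
  obtain ⟨q, hq, hq0⟩ := hF
  refine ⟨q, hq, ?_⟩
  have h1 : Polynomial.aeval (F M) (q.map (algebraMap R A)) = 0 := by
    rw [Polynomial.aeval_map_algebraMap]; exact hq0
  have h2 := spectrum.subset_polynomial_aeval (F M) (q.map (algebraMap R A))
    (Set.mem_image_of_mem _ hμ')
  rw [h1] at h2
  have h3 : (q.map (algebraMap R A)).eval μ = 0 := by
    by_contra h4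
    refine spectrum.mem_iff.mp h2 ?_
    rw [sub_zero]
    exact (IsUnit.mk0 _ h4).map (algebraMap A (Matrix n n A))
  rwa [Polynomial.eval_map] at h3

lemma isIntegral_of_mul_eq_smul {H : Type*} [Ring H] [Algebra K H] [Algebra R H]
    [IsScalarTower R K H] {y v : H} {a : K} (hy : IsIntegral R y) (hv : v ≠ 0)
    (h : y * v = a • v) : IsIntegral R a := by
  obtain ⟨q, hq, hq0⟩ := hy
  refine ⟨q, hq, ?_⟩
  have key : ∀ r : Polynomial K, Polynomial.aeval y r * v = r.eval a • v := by
    intro r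
    induction r using Polynomial.induction_on' with
    | add r s hr hs => simp only [map_add, add_mul, hr, hs, Polynomial.eval_add, add_smul]
    | monomial n c =>
      have hn : ∀ n : ℕ, y ^ n * v = a ^ n • v := by
        intro n
        induction n with
        | zero => simp
        | succ n ih => rw [pow_succ, mul_assoc, h, mul_smul_comm, ih, smul_smul, pow_succ']
      rw [Polynomial.aeval_monomial, mul_assoc, hn, Polynomial.eval_monomial, mul_smul,
        Algebra.smul_def c]
  have h1 := key (q.map (algebraMap R K))
  rw [Polynomial.aeval_map_algebraMap, Polynomial.eval_map] at h1
  have h0 : Polynomial.aeval y q = 0 := hq0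
  rw [h0, zero_mul] at h1
  exact (smul_eq_zero.mp h1.symm).resolve_right hv

end Integrality

/-! ### Slices of tensors -/

section Slices

variable {K H : Type*} [Field K] [Ring H] [Algebra K H]

/-- `a ⊗ b ↦ ξ(a) b`. -/
noncomputable def sliceL (ξ : H →ₗ[K] K) : H ⊗[K] H →ₗ[K] H :=
  (TensorProduct.lid K H).toLinearMap ∘ₗ ξ.rTensor H

/-- `a ⊗ b ↦ ξ(b) a`. -/
noncomputable def sliceR (ξ : H →ₗ[K] K) : H ⊗[K] H →ₗ[K] H :=
  (TensorProduct.rid K H).toLinearMap ∘ₗ ξ.lTensor H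

@[simp] lemma sliceL_tmul (ξ : H →ₗ[K] K) (a b : H) : sliceL ξ (a ⊗ₜ b) = ξ a • b := by
  simp [sliceL]

@[simp] lemma sliceR_tmul (ξ : H →ₗ[K] K) (a b : H) : sliceR ξ (a ⊗ₜ b) = ξ b • a := by
  simp [sliceR]

lemma apply_sliceR (ξ φ : H →ₗ[K] K) (w : H ⊗[K] H) : ξ (sliceR φ w) = φ (sliceL ξ w) := by
  induction w with
  | zero => simp
  | add a b ha hb => simp only [map_add, ha, hb]
  | tmul a b => simp [mul_comm]

end Slices

/-! ### The dual lattice of a Hopf order -/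

section Lattice

variable {R K H : Type*} [CommRing R] [Field K] [Algebra R K] [Ring H]
  [HopfAlgebra K H] [Algebra R H] [IsScalarTower R K H]

/-- The functionals on `H` that take values in `R` on the `R`-submodule `Y`. -/
def dualLattice (Y : Submodule R H) : Submodule R (H →ₗ[K] K) where
  carrier := {ξ | ∀ y ∈ Y, ξ y ∈ (1 : Submodule R K)}
  zero_mem' := fun y _ => by simp
  add_mem' := fun {a b} ha hb y hy => Submodule.add_mem _ (ha y hy) (hb y hy)
  smul_mem' := fun r a ha y hy => Submodule.smul_mem _ r (ha y hy)

/-- The image of `Y ⊗_R Y` in `H ⊗_K H`. -/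
def tensorSquare (K : Type*) {H R : Type*} [CommRing R] [Field K] [Algebra R K] [Ring H]
    [HopfAlgebra K H] [Algebra R H] [IsScalarTower R K H] (Y : Submodule R H) :
    Submodule R (H ⊗[K] H) :=
  Submodule.span R (Set.image2 (fun a b : H => a ⊗ₜ[K] b) Y Y)

lemma smul_mem_of_mem_one {M : Type*} [AddCommGroup M] [Module R M] [Module K M]
    [IsScalarTower R K M] (Y : Submodule R M) {a : K} (ha : a ∈ (1 : Submodule R K)) {y : M}
    (hy : y ∈ Y) : a • y ∈ Y := by
  obtain ⟨r, rfl⟩ := Submodule.mem_one.mp ha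
  rw [algebraMap_smul]
  exact Y.smul_mem r hy

variable {Y : Submodule R H}

lemma tmul_mem_tensorSquare {a b : H} (ha : a ∈ Y) (hb : b ∈ Y) :
    a ⊗ₜ[K] b ∈ tensorSquare K Y :=
  Submodule.subset_span ⟨a, ha, b, hb, rfl⟩

/-- An `R`-linear condition on `Y ⊗ Y` can be checked on pure tensors. -/
lemma map_mem_of_mem_tensorSquare {M : Type*} [AddCommGroup M] [Module R M] [Module K M]
    [IsScalarTower R K M] (F : H ⊗[K] H →ₗ[K] M) (Z : Submodule R M)
    (h : ∀ a ∈ Y, ∀ b ∈ Y, F (a ⊗ₜ b) ∈ Z) {w : H ⊗[K] H} (hw : w ∈ tensorSquare K Y) :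
    F w ∈ Z := by
  have h1 : tensorSquare K Y ≤ Z.comap (F.restrictScalars R) := by
    refine Submodule.span_le.mpr ?_
    rintro _ ⟨a, ha, b, hb, rfl⟩
    exact h a ha b hb
  exact h1 hw

lemma sliceL_mem {ξ : H →ₗ[K] K} (hξ : ξ ∈ dualLattice Y) {w : H ⊗[K] H}
    (hw : w ∈ tensorSquare K Y) : sliceL ξ w ∈ Y :=
  map_mem_of_mem_tensorSquare _ Y (fun a ha b hb => by
    rw [sliceL_tmul]; exact smul_mem_of_mem_one Y (hξ a ha) hb) hw

/-- The convolution product on the dual of `H`. -/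
noncomputable def convProd (ξ η : H →ₗ[K] K) : H →ₗ[K] K :=
  η ∘ₗ sliceL ξ ∘ₗ Coalgebra.comul

namespace IsHopfOrder

variable (hY : IsHopfOrder R K Y)
include hY

lemma comul_mem_tensorSquare {y : H} (hy : y ∈ Y) :
    Coalgebra.comul (R := K) y ∈ tensorSquare K Y := hY.comul_mem y hy

lemma counit_mem_dualLattice : (Coalgebra.counit : H →ₗ[K] K) ∈ dualLattice Y := fun y hy =>
  Submodule.mem_one.mpr (hY.counit_mem y hy)

lemma mul_mem_tensorSquare {v w : H ⊗[K] H} (hv : v ∈ tensorSquare K Y)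
    (hw : w ∈ tensorSquare K Y) : v * w ∈ tensorSquare K Y := by
  refine map_mem_of_mem_tensorSquare (LinearMap.mulRight K w) _ (fun a ha b hb => ?_) hv
  refine map_mem_of_mem_tensorSquare (LinearMap.mulLeft K (a ⊗ₜ b)) _ (fun c hc d hd => ?_) hw
  rw [LinearMap.mulLeft_apply, Algebra.TensorProduct.tmul_mul_tmul]
  exact tmul_mem_tensorSquare (hY.mul_mem _ ha _ hc) (hY.mul_mem _ hb _ hd)

lemma convProd_mem {ξ η : H →ₗ[K] K} (hξ : ξ ∈ dualLattice Y) (hη : η ∈ dualLattice Y) :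
    convProd ξ η ∈ dualLattice Y := fun _ hy =>
  hη _ (sliceL_mem hξ (hY.comul_mem_tensorSquare hy))

lemma pow_mem {y : H} (hy : y ∈ Y) (n : ℕ) : y ^ n ∈ Y := by
  induction n with
  | zero => rw [pow_zero]; exact hY.one_mem
  | succ n ih => rw [pow_succ]; exact hY.mul_mem _ ih _ hy

/-- A Hopf order is a projective module, so it has a finite dual basis. -/
lemma exists_dualBasis : ∃ (n : ℕ) (y : Fin n → H) (ξ : Fin n → (H →ₗ[K] K)),
    (∀ i, y i ∈ Y) ∧ (∀ i, ξ i ∈ dualLattice Y) ∧ ∀ h, h = ∑ i, ξ i h • y i := by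
  have := hY.finite
  have := hY.projective
  obtain ⟨n, g, hg⟩ := Module.Finite.exists_fin' R Y
  obtain ⟨s, hs⟩ := Module.projective_lifting_property g LinearMap.id hg
  let ξ : Fin n → (H →ₗ[K] K) := fun i =>
    hY.isBaseChange.lift ((Algebra.linearMap R K) ∘ₗ LinearMap.proj i ∘ₗ s)
  have hξ : ∀ i (z : Y), ξ i z = algebraMap R K (s z i) := fun i z =>
    hY.isBaseChange.lift_eq _ z
  refine ⟨n, fun i => g (Pi.single i 1), ξ, fun i => (g _).2, fun i z hz => ?_, fun h => ?_⟩
  · exact Submodule.mem_one.mpr ⟨_, (hξ i ⟨z, hz⟩).symm⟩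
  · have h1 : (LinearMap.id : H →ₗ[K] H) =
        ∑ i, (ξ i).smulRight ((g (Pi.single i 1) : Y) : H) := by
      refine hY.isBaseChange.algHom_ext _ _ fun z => ?_
      rw [LinearMap.id_apply, LinearMap.sum_apply]
      simp only [LinearMap.smulRight_apply, Submodule.subtype_apply, hξ, algebraMap_smul]
      have h2 : z = ∑ i, s z i • g (Pi.single i 1) := by
        conv_lhs => rw [show z = g (s z) from (LinearMap.congr_fun hs z).symm]
        conv_lhs => rw [← LinearMap.sum_single_apply (fun _ => R) (s z), map_sum]
        refine Finset.sum_congr rfl fun i _ => ?_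
        rw [← map_smul]
        congr 1
        ext j
        simp [Pi.single_apply]
      conv_lhs => rw [h2]
      simp
    simpa using LinearMap.congr_fun h1 h

/-- A Hopf order is the dual of its dual lattice. -/
lemma mem_of_forall_dualLattice {h : H} (hh : ∀ ξ ∈ dualLattice (K := K) Y, ξ h ∈ (1 : Submodule R K)) :
    h ∈ Y := by
  obtain ⟨n, y, ξ, hy, hξ, hsum⟩ := hY.exists_dualBasis
  rw [hsum h]
  exact Submodule.sum_mem _ fun i _ => smul_mem_of_mem_one Y (hh _ (hξ i)) (hy i)

lemma dualLattice_fg : (dualLattice (K := K) Y).FG := by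
  obtain ⟨n, y, ξ, hy, hξ, hsum⟩ := hY.exists_dualBasis
  have : dualLattice (K := K) Y = Submodule.span R (Set.range ξ) := by
    refine le_antisymm (fun η hη => ?_) (Submodule.span_le.mpr ?_)
    · have h1 : η = ∑ i, η (y i) • ξ i := by
        ext h
        conv_lhs => rw [hsum h]
        simp [mul_comm]
      rw [h1]
      refine Submodule.sum_mem _ fun i _ => ?_
      exact smul_mem_of_mem_one _ (hη _ (hy i)) (Submodule.subset_span ⟨i, rfl⟩)
    · rintro _ ⟨i, rfl⟩
      exact hξ i
  rw [this]
  exact Submodule.fg_span (Set.finite_range ξ)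

lemma isIntegral_of_mem {y : H} (hy : y ∈ Y) : IsIntegral R y := by
  let S : Subalgebra R H := Y.toSubalgebra hY.one_mem (fun a b ha hb => hY.mul_mem a ha b hb)
  refine IsIntegral.of_mem_of_fg S ?_ y hy
  have := hY.finite
  exact (Submodule.fg_top Y).mp (Module.finite_def.mp this)

/-- A slice along a functional that is only known to be integral on `Y ∩ V`, for a tensor whose
right legs lie in `V`. -/
lemma sliceR_mem {V : Submodule K H} {φ : H →ₗ[K] K}
    (hφ : ∀ y ∈ Y, y ∈ V → φ y ∈ (1 : Submodule R K)) {w : H ⊗[K] H} (hw : w ∈ tensorSquare K Y)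
    (hV : ∀ ξ : H →ₗ[K] K, sliceL ξ w ∈ V) : sliceR φ w ∈ Y := by
  refine hY.mem_of_forall_dualLattice fun ξ hξ => ?_
  rw [apply_sliceR]
  exact hφ _ (sliceL_mem hξ hw) (hV ξ)

variable [IsIntegrallyClosed R] [IsFractionRing R K]

omit hY in
lemma _root_.Submodule.mem_one_of_isIntegral {a : K} (ha : IsIntegral R a) : a ∈ (1 : Submodule R K) :=
  Submodule.mem_one.mpr (IsIntegrallyClosed.isIntegral_iff.mp ha)

/-- Characters of `H` are integral on every Hopf order. -/
lemma trace_mem_dualLattice {n : Type*} [Fintype n] [DecidableEq n]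
    (ρ : H →ₐ[K] Matrix n n K) :
    Matrix.traceLinearMap n K K ∘ₗ ρ.toLinearMap ∈ dualLattice Y := fun _ hy =>
  Submodule.mem_one_of_isIntegral <| Matrix.isIntegral_trace_of_isIntegral <|
    (hY.isIntegral_of_mem hy).map (ρ.restrictScalars R)

/-- Characters of comodules lie in every Hopf order: the dual lattice acts on a comodule through an
`R`-algebra of matrices that is a finitely generated module, so its traces are integral. -/
lemma sum_diag_mem {n : Type*} [Fintype n] [DecidableEq n] (m : n → n → H)
    (hm : ∀ i j, Coalgebra.comul (R := K) (m i j) = ∑ k, m i k ⊗ₜ[K] m k j)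
    (hm1 : ∀ i j, Coalgebra.counit (R := K) (m i j) = if i = j then 1 else 0) :
    ∑ i, m i i ∈ Y := by
  refine hY.mem_of_forall_dualLattice fun ξ hξ => ?_
  let Φ : (H →ₗ[K] K) →ₗ[R] Matrix n n K :=
    { toFun := fun ξ => Matrix.of fun i j => ξ (m i j)
      map_add' := fun a b => by ext; simp
      map_smul' := fun r a => by ext; simp }
  have hmul : ∀ a b, Φ a * Φ b = Φ (convProd a b) := by
    intro a b
    ext i j
    simp [Φ, Matrix.mul_apply, convProd, hm]
  have hone : Φ Coalgebra.counit = 1 := by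
    ext i j
    simp [Φ, Matrix.one_apply, hm1]
  let S : Subalgebra R (Matrix n n K) := ((dualLattice (K := K) Y).map Φ).toSubalgebra
    ⟨_, hY.counit_mem_dualLattice, hone⟩ (by
      rintro _ _ ⟨a, ha, rfl⟩ ⟨b, hb, rfl⟩
      exact ⟨_, hY.convProd_mem ha hb, (hmul a b).symm⟩)
  have hint : IsIntegral R (Φ ξ) :=
    IsIntegral.of_mem_of_fg S (hY.dualLattice_fg.map Φ) _ ⟨ξ, hξ, rfl⟩
  have := Submodule.mem_one_of_isIntegral (Matrix.isIntegral_trace_of_isIntegral hint)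
  simpa [Φ, Matrix.trace] using this

end IsHopfOrder

end Lattice

/-! ### Bases of bismash type -/

/-- A basis `b(x, q)`, `x ∈ X`, `q ∈ Q`, of a Hopf algebra `H` in which the structure maps are those
of the double groupoid given by an action of `Q` on the abelian group `X` and a homomorphism
`p : X → Q`. The product is that of the action groupoid of `Q` on `X`. Dually, `X` carries the group
law `α ∘ β = α · (p(α)⁻¹ ▹ β)`, it acts on the set `Q` by `α ↦ p(α) q p(q⁻¹ ▹ α)⁻¹`, and the
coproduct is dual to the composition in the action groupoid. For `(KG)_J` the group `X` is `N̂`, and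
`b(ν, q) = e_ν q`. -/
structure BismashBasis (K X Q H : Type*) [Field K] [CommGroup X] [Fintype X] [DecidableEq X]
    [Group Q] [Ring H] [HopfAlgebra K H] where
  /-- The action of `Q` on `X`. -/
  act : Q →* MulAut X
  /-- The homomorphism `X → Q`. -/
  p : X →* Q
  p_act : ∀ x y, p (act (p x) y) = p y
  /-- The basis. -/
  basis : Module.Basis (X × Q) K H
  mul' : ∀ x q y r, basis (x, q) * basis (y, r) = if x = act q y then basis (x, q * r) else 0
  one' : 1 = ∑ x, basis (x, 1)
  comul' : ∀ x q, Coalgebra.comul (R := K) (basis (x, q)) =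
    ∑ α, basis (α, q) ⊗ₜ[K] basis (act (p α) (α⁻¹ * x), p α * q * (p (act q⁻¹ α))⁻¹)
  counit' : ∀ x q, Coalgebra.counit (R := K) (basis (x, q)) = if x = 1 then 1 else 0
  antipode' : ∀ x q, HopfAlgebra.antipode K (basis (x, q)) =
    basis (act (p (act q⁻¹ x)) (act q⁻¹ x⁻¹), p (act q⁻¹ x) * q⁻¹ * (p x)⁻¹)

namespace BismashBasis

variable {K X Q H : Type*} [Field K] [CommGroup X] [Fintype X] [DecidableEq X]
  [Group Q] [Ring H] [HopfAlgebra K H] (D : BismashBasis K X Q H)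

section Groupoid

lemma act_mul (q r : Q) (x : X) : D.act (q * r) x = D.act q (D.act r x) := by
  rw [map_mul, MulAut.mul_apply]

@[simp] lemma act_one (x : X) : D.act 1 x = x := by rw [map_one, MulAut.one_apply]

@[simp] lemma act_act_inv (q : Q) (x : X) : D.act q (D.act q⁻¹ x) = x := by
  rw [← act_mul, mul_inv_cancel, act_one]

@[simp] lemma act_inv_act (q : Q) (x : X) : D.act q⁻¹ (D.act q x) = x := by
  rw [← act_mul, inv_mul_cancel, act_one]

lemma act_inv_eq_iff {q : Q} {x y : X} : D.act q⁻¹ x = y ↔ x = D.act q y :=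
  ⟨fun h => by rw [← h, act_act_inv], fun h => by rw [h, act_inv_act]⟩

@[simp] lemma p_act_p (x y : X) : D.p (D.act (D.p x) y) = D.p y := D.p_act x y

@[simp] lemma p_act_p_inv (x y : X) : D.p (D.act (D.p x)⁻¹ y) = D.p y := by
  rw [← map_inv, p_act_p]

lemma p_comm (x y : X) : D.p x * D.p y = D.p y * D.p x := by
  rw [← map_mul, mul_comm, map_mul]

/-- The end point of the arrow `α` that starts at `q`. -/
def tgt (α : X) (q : Q) : Q := D.p α * q * (D.p (D.act q⁻¹ α))⁻¹

/-- The solution `β` of `α ∘ β = x`. -/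
def quo (α x : X) : X := D.act (D.p α) (α⁻¹ * x)

/-- The product `α ∘ β`. -/
def comp (α β : X) : X := α * D.act (D.p α)⁻¹ β

@[simp] lemma quo_comp (α β : X) : D.quo α (D.comp α β) = β := by simp [quo, comp]

@[simp] lemma comp_quo (α x : X) : D.comp α (D.quo α x) = x := by simp [quo, comp]

lemma quo_eq_iff {α x β : X} : D.quo α x = β ↔ x = D.comp α β :=
  ⟨fun h => by rw [← h, comp_quo], fun h => by rw [h, quo_comp]⟩

/-- Left translation by `α` for the group law `∘`. -/
def compEquiv (α : X) : X ≃ X where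
  toFun := D.comp α
  invFun := D.quo α
  left_inv := D.quo_comp α
  right_inv := D.comp_quo α

@[simp] lemma p_comp (α β : X) : D.p (D.comp α β) = D.p α * D.p β := by
  rw [comp, map_mul, p_act_p_inv]

@[simp] lemma p_quo (α x : X) : D.p (D.quo α x) = (D.p α)⁻¹ * D.p x := by simp [quo]

@[simp] lemma quo_one_quo (α : X) : D.quo (D.quo α 1) 1 = α := by
  simp [quo]

@[simp] lemma quo_one_left (x : X) : D.quo 1 x = x := by simp [quo]

@[simp] lemma comp_one_left (x : X) : D.comp 1 x = x := by
  rw [comp, map_one, inv_one, act_one, one_mul]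

@[simp] lemma tgt_one (q : Q) : D.tgt 1 q = q := by simp [tgt]

@[simp] lemma tgt_at_one (α : X) : D.tgt α 1 = 1 := by simp [tgt]

lemma act_tgt_inv (α β : X) (q : Q) :
    D.act (D.tgt α q)⁻¹ β = D.act (D.p (D.act q⁻¹ α)) (D.act q⁻¹ (D.act (D.p α)⁻¹ β)) := by
  simp only [tgt, mul_inv_rev, inv_inv, act_mul, mul_assoc]

lemma tgt_tgt (α β : X) (q : Q) : D.tgt β (D.tgt α q) = D.tgt (D.comp α β) q := by
  have h1 : D.p (D.act (D.tgt α q)⁻¹ β) = D.p (D.act q⁻¹ (D.act (D.p α)⁻¹ β)) := by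
    rw [act_tgt_inv, p_act_p]
  conv_lhs => rw [tgt, h1]
  rw [tgt, tgt, p_comp, D.p_comm α β, comp, map_mul (D.act q⁻¹), map_mul D.p,
    D.p_comm (D.act q⁻¹ α)]
  simp only [mul_inv_rev, mul_assoc]

lemma tgt_quo (α x : X) (q : Q) : D.tgt (D.quo α x) (D.tgt α q) = D.tgt x q := by
  rw [tgt_tgt, comp_quo]

lemma tgt_inverse (α : X) (q : Q) : D.tgt (D.quo α 1) (D.tgt α q) = q := by
  rw [tgt_quo, tgt_one]

lemma tgt_of_fix {α : X} {q : Q} (h : D.act q α = α) : D.tgt α q = D.p α * q * (D.p α)⁻¹ := by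
  rw [tgt, D.act_inv_eq_iff.mpr h.symm]

/-- If `q` fixes `α`, then the end point of `α` fixes the inverse of `α` for `∘`. -/
lemma fix_quo {α : X} {q : Q} (h : D.act q α = α) :
    D.act (D.tgt α q) (D.quo α 1) = D.quo α 1 := by
  rw [D.tgt_of_fix h, quo, mul_one]
  have h1 : D.act q α⁻¹ = α⁻¹ := by rw [map_inv, h]
  rw [act_mul, act_mul, act_inv_act, h1]

end Groupoid

section Structure

/-- The basis elements. -/
noncomputable abbrev b (x : X) (q : Q) : H := D.basis (x, q)

/-- The coordinate functionals. -/
noncomputable abbrev coef (x : X) (q : Q) : H →ₗ[K] K := D.basis.coord (x, q)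

lemma b_mul (x : X) (q : Q) (y : X) (r : Q) :
    D.b x q * D.b y r = if x = D.act q y then D.b x (q * r) else 0 := D.mul' x q y r

lemma b_mul_of_eq {x : X} {q : Q} {y : X} (r : Q) (h : x = D.act q y) :
    D.b x q * D.b y r = D.b x (q * r) := by rw [b_mul, if_pos h]

lemma comul_b (x : X) (q : Q) : Coalgebra.comul (R := K) (D.b x q) =
    ∑ α, D.b α q ⊗ₜ[K] D.b (D.quo α x) (D.tgt α q) := D.comul' x q

lemma b_ne_zero (x : X) (q : Q) : D.b x q ≠ 0 := D.basis.ne_zero _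

lemma coef_b [DecidableEq Q] (x : X) (q : Q) (y : X) (r : Q) :
    D.coef x q (D.b y r) = if y = x ∧ r = q then 1 else 0 := by
  rw [Module.Basis.coord_apply, Module.Basis.repr_self, Finsupp.single_apply]
  simp only [Prod.mk.injEq]

@[simp] lemma coef_b_self (x : X) (q : Q) : D.coef x q (D.b x q) = 1 := by
  classical rw [coef_b, if_pos ⟨rfl, rfl⟩]

lemma eq_sum [Fintype Q] (h : H) : h = ∑ x, ∑ q, D.coef x q h • D.b x q := by
  rw [← Fintype.sum_prod_type' (f := fun x q => D.coef x q h • D.b x q)]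
  exact (D.basis.sum_repr h).symm

/-- The idempotent `∑_{x ∈ S} b(x, 1)`. -/
noncomputable def idem (S : Finset X) : H := ∑ x ∈ S, D.b x 1

lemma idem_mul_b (S : Finset X) (x : X) (q : Q) :
    D.idem S * D.b x q = if x ∈ S then D.b x q else 0 := by
  rw [idem, Finset.sum_mul]
  simp_rw [b_mul, act_one, one_mul]
  split_ifs with h
  · rw [Finset.sum_eq_single_of_mem x h (fun y _ hy => if_neg hy), if_pos rfl]
  · exact Finset.sum_eq_zero fun y hy => if_neg (ne_of_mem_of_not_mem hy h)

lemma b_mul_idem (S : Finset X) (x : X) (q : Q) :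
    D.b x q * D.idem S = if D.act q⁻¹ x ∈ S then D.b x q else 0 := by
  rw [idem, Finset.mul_sum]
  simp_rw [b_mul, mul_one, ← act_inv_eq_iff]
  rw [Finset.sum_ite_eq]

lemma idem_univ : D.idem Finset.univ = 1 := D.one'.symm

lemma idem_mul_idem (S T : Finset X) : D.idem S * D.idem T = D.idem (S ∩ T) := by
  conv_lhs => rw [idem.eq_1 D T]
  rw [Finset.mul_sum]
  simp_rw [idem_mul_b]
  rw [← Finset.sum_filter, Finset.filter_mem_eq_inter, Finset.inter_comm, idem]

lemma b_one_mul [Fintype Q] (x : X) (h : H) :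
    D.b x 1 * h = ∑ q, D.coef x q h • D.b x q := by
  conv_lhs => rw [D.eq_sum h]
  simp_rw [Finset.mul_sum, mul_smul_comm, b_mul, act_one, one_mul]
  rw [Finset.sum_eq_single x]
  · simp
  · intro y _ hy; simp [hy.symm]
  · simp

/-- The span of the elements `b(x, 1)`. -/
def base : Submodule K H := Submodule.span K (Set.range fun x => D.b x 1)

lemma b_mem_base (x : X) : D.b x 1 ∈ D.base := Submodule.subset_span ⟨x, rfl⟩

lemma mul_b_of_mem_base {h : H} (hh : h ∈ D.base) (x : X) :
    h * D.b x 1 = D.coef x 1 h • D.b x 1 := by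
  classical
  induction hh using Submodule.span_induction with
  | mem h hh =>
    obtain ⟨y, rfl⟩ := hh
    dsimp only
    rw [b_mul, coef_b, act_one, mul_one]
    by_cases hyx : y = x
    · subst hyx; simp
    · simp [hyx]
  | zero => simp
  | add a c _ _ ha hc => rw [add_mul, ha, hc, map_add, add_smul]
  | smul r a _ ha => rw [smul_mul_assoc, ha, map_smul, smul_eq_mul, mul_smul]

/-- The representation of `H` on `K^X`, in which `b(x, q)` is the matrix unit at `(x, q⁻¹ ▹ x)`. -/
noncomputable def permRep : H →ₐ[K] Matrix X X K :=
  AlgHom.ofLinearMap (D.basis.constr K fun g => Matrix.single g.1 (D.act g.2⁻¹ g.1) 1)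
    (by
      rw [D.one', map_sum]
      simp only [Module.Basis.constr_basis, inv_one, act_one]
      exact Matrix.sum_single_one)
    (by
      intro a c
      set ρ := D.basis.constr K fun g => Matrix.single g.1 (D.act g.2⁻¹ g.1) (1 : K) with hρ
      have h : (LinearMap.mul K H).compr₂ ρ = (LinearMap.mul K (Matrix X X K)).compl₁₂ ρ ρ := by
        refine D.basis.ext fun g => D.basis.ext fun g' => ?_
        obtain ⟨x, q⟩ := g
        obtain ⟨y, r⟩ := g'
        simp only [LinearMap.compr₂_apply, LinearMap.mul_apply', LinearMap.compl₁₂_apply, D.mul']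
        split_ifs with hx
        · subst hx
          simp only [hρ, Module.Basis.constr_basis, mul_inv_rev, act_mul, act_inv_act]
          rw [Matrix.single_mul_single_same, one_mul]
        · simp only [map_zero, hρ, Module.Basis.constr_basis]
          rw [Matrix.single_mul_single_of_ne]
          rwa [ne_eq, act_inv_eq_iff]
      exact LinearMap.congr_fun₂ h a c)

/-- The character of `permRep`. -/
noncomputable def permChar : H →ₗ[K] K :=
  Matrix.traceLinearMap X K K ∘ₗ D.permRep.toLinearMap

lemma permChar_b (x : X) (q : Q) : D.permChar (D.b x q) = if D.act q x = x then 1 else 0 := by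
  have : D.permRep (D.b x q) = Matrix.single x (D.act q⁻¹ x) 1 := by
    change D.basis.constr K _ (D.basis (x, q)) = _
    rw [Module.Basis.constr_basis]
  simp only [permChar, LinearMap.comp_apply, AlgHom.toLinearMap_apply, this,
    Matrix.traceLinearMap_apply]
  split_ifs with h
  · rw [D.act_inv_eq_iff.mpr h.symm, Matrix.trace_single_eq_same]
  · rw [Matrix.trace_single_eq_of_ne]
    intro h'
    exact h (D.act_inv_eq_iff.mp h'.symm).symm

lemma sliceL_comul_b (ξ : H →ₗ[K] K) (x : X) (q : Q) :
    sliceL ξ (Coalgebra.comul (R := K) (D.b x q)) =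
      ∑ α, ξ (D.b α q) • D.b (D.quo α x) (D.tgt α q) := by
  rw [comul_b, map_sum]
  simp

lemma sliceL_coef_comul [Fintype Q] (q : Q) (h : H) :
    sliceL (D.coef 1 q) (Coalgebra.comul (R := K) h) = ∑ x, D.coef x q h • D.b x q := by
  classical
  conv_lhs => rw [D.eq_sum h]
  simp_rw [map_sum, map_smul, sliceL_comul_b, coef_b]
  refine Finset.sum_congr rfl fun x _ => ?_
  rw [Finset.sum_eq_single q]
  · congr 1
    rw [Finset.sum_eq_single 1]
    · simp
    · intro α _ hα; simp [hα]
    · simp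
  · intro r _ hr
    simp [hr]
  · simp

end Structure

section Lattice

variable {R : Type*} [CommRing R] [Algebra R K] [Algebra R H] [IsScalarTower R K H]
  [IsIntegrallyClosed R] [IsFractionRing R K] {Y : Submodule R H} (hY : IsHopfOrder R K Y)
include hY

lemma coef_mem_of_mem_base {y : H} (hy : y ∈ Y) (hV : y ∈ D.base) (x : X) :
    D.coef x 1 y ∈ (1 : Submodule R K) :=
  Submodule.mem_one_of_isIntegral <| isIntegral_of_mul_eq_smul (hY.isIntegral_of_mem hy)
    (D.b_ne_zero x 1) (D.mul_b_of_mem_base hV x)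

/-- Evaluating the right leg of a tensor in `Y ⊗ Y` at a point of `X`. -/
lemma sum_coef_smul_mem {ι : Type*} (s : Finset ι) (u v : ι → H) (hv : ∀ i ∈ s, v i ∈ D.base)
    (hw : ∑ i ∈ s, u i ⊗ₜ[K] v i ∈ tensorSquare K Y) (x : X) :
    ∑ i ∈ s, D.coef x 1 (v i) • u i ∈ Y := by
  have := hY.sliceR_mem (V := D.base) (φ := D.coef x 1)
    (fun y hy hV => D.coef_mem_of_mem_base hY hy hV x) hw (fun ξ => by
      rw [map_sum]
      refine Submodule.sum_mem _ fun i hi => ?_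
      rw [sliceL_tmul]
      exact Submodule.smul_mem _ _ (hv i hi))
  rw [map_sum] at this
  simpa only [sliceR_tmul] using this

/-- The character of the comodule attached to a set of objects that is closed under arrows. -/
lemma sum_loops_mem [DecidableEq Q] (O : Finset Q) (hO : ∀ q ∈ O, ∀ α, D.tgt α q ∈ O) :
    ∑ q ∈ O, ∑ α, (if D.tgt α q = q then D.b α q else 0) ∈ Y := by
  have key := hY.sum_diag_mem (K := K)
    (fun i j : O => ∑ α, if D.tgt α i = j then D.b α (i : Q) else 0) ?_ ?_
  · rw [← Finset.sum_coe_sort] 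
    exact key
  · intro i j
    have h1 : ∀ α, ∑ k : O, ((if D.tgt α i = k then D.b α (i : Q) else 0) ⊗ₜ[K]
        ∑ β, if D.tgt β k = j then D.b β (k : Q) else 0) =
        D.b α i ⊗ₜ[K] ∑ β, if D.tgt β (D.tgt α i) = j then D.b β (D.tgt α i) else 0 := by
      intro α
      rw [Finset.sum_eq_single ⟨D.tgt α i, hO _ i.2 α⟩]
      · simp
      · intro k _ hk
        rw [if_neg, TensorProduct.zero_tmul]
        intro h
        exact hk (Subtype.ext h.symm)
      · simp
    simp_rw [TensorProduct.sum_tmul]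
    rw [Finset.sum_comm]
    simp_rw [h1, map_sum, apply_ite Coalgebra.comul, comul_b, map_zero, TensorProduct.tmul_sum]
    have h2 : ∀ x, (if D.tgt x i = j then ∑ α, D.b α (i : Q) ⊗ₜ[K]
        D.b (D.quo α x) (D.tgt α i) else 0) = ∑ α, if D.tgt x i = j then D.b α (i : Q) ⊗ₜ[K]
        D.b (D.quo α x) (D.tgt α i) else 0 := by
      intro x; split_ifs <;> simp
    simp_rw [h2]
    rw [Finset.sum_comm]
    refine Finset.sum_congr rfl fun α _ => ?_
    refine Fintype.sum_equiv (D.compEquiv α).symm _ _ fun x => ?_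
    change _ = D.b α i ⊗ₜ[K] (if D.tgt (D.quo α x) _ = _ then D.b (D.quo α x) _ else 0)
    rw [tgt_quo]
    split_ifs <;> simp
  · intro i j
    rw [map_sum, Finset.sum_eq_single 1]
    · rw [tgt_one]
      by_cases hij : i = j
      · subst hij
        simp [b, D.counit']
      · rw [if_neg hij, if_neg, map_zero]
        exact fun h => hij (Subtype.ext h)
    · intro α _ hα
      split_ifs
      · simp [b, D.counit', hα]
      · simp
    · simp

end Lattice

end BismashBasis

/-! ### The idempotents of the base -/

namespace BismashBasis

variable {K X Q H : Type*} [Field K] [CommGroup X] [Fintype X] [DecidableEq X]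
  [Group Q] [Ring H] [HopfAlgebra K H] (D : BismashBasis K X Q H)

/-- A set `O ⊆ Q` that is stable under multiplication by the image of `p` on both sides, on which
the action of `(X, ∘)` is free, and such that the elements of `O` with a nontrivial fixed point in
`X` form a single conjugacy class under the image of `p` and have pairwise disjoint sets of
nontrivial fixed points. -/
structure IsIsolating (O : Finset Q) : Prop where
  mul_mem : ∀ q ∈ O, ∀ α β, D.p α * q * D.p β ∈ O
  loop : ∀ q ∈ O, ∀ α, D.tgt α q = q → α = 1
  ker : ∀ q ∈ O, ∀ α, D.p α = 1 → D.p (D.act q⁻¹ α) = 1 → α = 1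
  uniq : ∀ q ∈ O, ∀ r ∈ O, ∀ x, x ≠ 1 → D.act q x = x → D.act r x = x → q = r
  conj : ∀ q ∈ O, ∀ r ∈ O, ∀ x, x ≠ 1 → ∀ y, y ≠ 1 → D.act q x = x → D.act r y = y →
    ∃ α, r = D.p α * q * (D.p α)⁻¹
  exists_fix : ∃ q ∈ O, ∃ x, x ≠ 1 ∧ D.act q x = x

/-- The nontrivial fixed points in `X` of the elements of `O`. -/
def fixSet [DecidableEq Q] (O : Finset Q) : Finset X :=
  Finset.univ.filter fun x => x ≠ 1 ∧ ∃ q ∈ O, D.act q x = x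

lemma mem_fixSet [DecidableEq Q] {O : Finset Q} {x : X} :
    x ∈ D.fixSet O ↔ x ≠ 1 ∧ ∃ q ∈ O, D.act q x = x := by
  simp [fixSet]

/-- The elements that translate the set `T` into itself. -/
def stab (T : Finset X) : Finset X := Finset.univ.filter fun α => ∀ β ∈ T, D.comp α β ∈ T

namespace IsIsolating

variable {D} {O : Finset Q} (hO : D.IsIsolating O)
include hO

lemma tgt_mem {q : Q} (hq : q ∈ O) (α : X) : D.tgt α q ∈ O := by
  rw [tgt, ← map_inv]
  exact hO.mul_mem q hq _ _

lemma conj_mem {q : Q} (hq : q ∈ O) (α : X) : D.p α * q * (D.p α)⁻¹ ∈ O := by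
  rw [← map_inv]
  exact hO.mul_mem q hq _ _

variable [DecidableEq Q]

lemma act_p_mem_fixSet {x : X} (hx : x ∈ D.fixSet O) (α : X) :
    D.act (D.p α) x ∈ D.fixSet O := by
  obtain ⟨hx1, q, hq, hqx⟩ := D.mem_fixSet.mp hx
  refine D.mem_fixSet.mpr ⟨?_, _, hO.conj_mem hq α, ?_⟩
  · rwa [ne_eq, EmbeddingLike.map_eq_one_iff]
  · rw [D.act_mul, D.act_mul, D.act_inv_act, hqx]

lemma p_ne_one {x : X} (hx : x ∈ D.fixSet O) : D.p x ≠ 1 := by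
  obtain ⟨hx1, q, hq, hqx⟩ := D.mem_fixSet.mp hx
  intro h
  refine hx1 (hO.ker q hq x h ?_)
  rw [D.act_inv_eq_iff.mpr hqx.symm, h]

lemma mul_mem_of_mem_stab {θ t : X} (hθ : θ ∈ D.stab (D.fixSet O)) (ht : t ∈ D.fixSet O) :
    θ * t ∈ D.fixSet O := by
  have := (Finset.mem_filter.mp hθ).2 _ (hO.act_p_mem_fixSet ht θ)
  rwa [comp, act_inv_act] at this

/-- Modulo the kernel of `p`, the set `fixSet O` is a subgroup without its identity element, and
such a set is stable under no nontrivial translation. -/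
lemma p_eq_one_of_mem_stab {θ : X} (hθ : θ ∈ D.stab (D.fixSet O)) : D.p θ = 1 := by
  obtain ⟨q, hq, t, ht1, hqt⟩ := hO.exists_fix
  obtain ⟨hx1, r, hr, hrx⟩ := D.mem_fixSet.mp
    (hO.mul_mem_of_mem_stab hθ (D.mem_fixSet.mpr ⟨ht1, q, hq, hqt⟩))
  obtain ⟨α, rfl⟩ := hO.conj r hr q hq _ hx1 t ht1 hrx hqt
  -- `s` is the fixed point of `q` with the same image under `p` as `θ`
  set s := D.act (D.p α) (θ * t) * t⁻¹ with hs
  have hps : D.p s = D.p θ := by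
    rw [hs, map_mul D.p, p_act_p, map_mul D.p, map_inv]
    group
  have hqs : D.act (D.p α * r * (D.p α)⁻¹) s = s := by
    rw [hs, map_mul, map_inv, hqt, D.act_mul, D.act_mul, D.act_inv_act, hrx]
  by_cases h1 : s = 1
  · rw [← hps, h1, map_one]
  · exfalso
    have h2 := hO.mul_mem_of_mem_stab hθ (t := s⁻¹) (D.mem_fixSet.mpr
      ⟨inv_ne_one.mpr h1, _, hq, by rw [map_inv, hqs]⟩)
    refine hO.p_ne_one h2 ?_
    rw [map_mul, map_inv, hps, mul_inv_cancel]

end IsIsolating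

variable {R : Type*} [CommRing R] [Algebra R K] [Algebra R H] [IsScalarTower R K H]
  [IsIntegrallyClosed R] [IsFractionRing R K] {Y : Submodule R H} (hY : IsHopfOrder R K Y)

section Base

include hY

variable [DecidableEq Q]

/-- The character of the comodule of `O` is `∑_{q ∈ O} b(1, q)`, by freeness.
Slicing the coproduct of this element along the permutation character isolates the
loops of `Q` on `X`. -/
lemma sum_fix_mem {O : Finset Q} (hO : D.IsIsolating O) :
    ∑ q ∈ O, ∑ x, (if x ≠ 1 ∧ D.act q x = x then D.b x q else 0) ∈ Y := by
  have hc : ∑ q ∈ O, D.b 1 q ∈ Y := by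
    have h := D.sum_loops_mem hY O (fun q hq α => hO.tgt_mem hq α)
    convert! h using 2 with q hq
    rw [Finset.sum_eq_single 1]
    · rw [tgt_one, if_pos rfl]
    · intro α _ hα
      exact if_neg fun h' => hα (hO.loop q hq α h')
    · simp
  have hs := sliceL_mem (hY.trace_mem_dualLattice D.permRep) (hY.comul_mem_tensorSquare hc)
  change sliceL D.permChar _ ∈ Y at hs
  simp_rw [map_sum, sliceL_comul_b, permChar_b, ite_smul, one_smul, zero_smul] at hs
  -- Inversion for `∘` is an involution of the loops of `Q` on `X`.
  have hre : ∑ q ∈ O, ∑ α, (if D.act q α = α then D.b (D.quo α 1) (D.tgt α q) else 0) =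
      ∑ q ∈ O, ∑ α, if D.act q α = α then D.b α q else 0 := by
    rw [← Finset.sum_product', ← Finset.sum_product', ← Finset.sum_filter, ← Finset.sum_filter]
    refine Finset.sum_nbij' (fun g => (D.tgt g.2 g.1, D.quo g.2 1))
      (fun g => (D.tgt g.2 g.1, D.quo g.2 1)) ?_ ?_ ?_ ?_ ?_
    · rintro ⟨q, α⟩ h
      simp only [Finset.mem_filter, Finset.mem_product, Finset.mem_univ, and_true] at h ⊢
      exact ⟨hO.tgt_mem h.1 α, D.fix_quo h.2⟩
    · rintro ⟨q, α⟩ h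
      simp only [Finset.mem_filter, Finset.mem_product, Finset.mem_univ, and_true] at h ⊢
      exact ⟨hO.tgt_mem h.1 α, D.fix_quo h.2⟩
    · rintro ⟨q, α⟩ _
      simp [tgt_inverse]
    · rintro ⟨q, α⟩ _
      simp [tgt_inverse]
    · rintro ⟨q, α⟩ _
      rfl
  rw [hre] at hs
  have := Y.sub_mem hs hc
  rw [← Finset.sum_sub_distrib] at this
  convert! this using 2 with q hq
  rw [← Finset.sum_erase_add _ _ (Finset.mem_univ (1 : X)),
    ← Finset.sum_erase_add (a := (1 : X)) _ (fun α => if D.act q α = α then D.b α q else 0)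
      (Finset.mem_univ (1 : X))]
  rw [if_neg (by simp), add_zero, if_pos (map_one _), add_sub_cancel_right]
  refine Finset.sum_congr rfl fun x hx => ?_
  simp [Finset.ne_of_mem_erase hx]

/-- The loops of `sum_fix_mem`, and all their powers, lie in `Y`. -/
lemma exists_loops_mem [Fintype Q] {O : Finset Q} (hO : D.IsIsolating O) :
    ∃ t : X → Q, (∀ x ∈ D.fixSet O, t x ∈ O ∧ D.act (t x) x = x) ∧
      ∀ n : ℕ, ∑ x ∈ D.fixSet O, D.b x (t x ^ n) ∈ Y := by
  classical
  have ht : ∀ x, ∃ q, x ∈ D.fixSet O → q ∈ O ∧ D.act q x = x := by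
    intro x
    by_cases hx : x ∈ D.fixSet O
    · obtain ⟨_, q, hq⟩ := D.mem_fixSet.mp hx
      exact ⟨q, fun _ => hq⟩
    · exact ⟨1, fun h => absurd h hx⟩
  choose t ht using ht
  have hpow : ∀ x ∈ D.fixSet O, ∀ n : ℕ, D.act (t x ^ n) x = x := by
    intro x hx n
    induction n with
    | zero => simp
    | succ n ih => rw [pow_succ, act_mul, (ht x hx).2, ih]
  have hz : ∑ x ∈ D.fixSet O, D.b x (t x) ∈ Y := by
    have := D.sum_fix_mem hY hO
    rw [Finset.sum_comm] at this
    convert! this using 1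
    rw [fixSet, Finset.sum_filter]
    refine Finset.sum_congr rfl fun x _ => ?_
    split_ifs with h
    · have hx := D.mem_fixSet.mpr h
      rw [Finset.sum_eq_single_of_mem (t x) (ht x hx).1, if_pos ⟨h.1, (ht x hx).2⟩]
      intro q hq hne
      exact if_neg fun h' => hne (hO.uniq q hq _ (ht x hx).1 x h.1 h'.2 (ht x hx).2)
    · refine (Finset.sum_eq_zero fun q hq => if_neg fun h' => h ⟨h'.1, q, hq, h'.2⟩).symm
  have hmul : ∀ n : ℕ, (∑ x ∈ D.fixSet O, D.b x (t x ^ n)) * ∑ x ∈ D.fixSet O, D.b x (t x) =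
      ∑ x ∈ D.fixSet O, D.b x (t x ^ (n + 1)) := by
    intro n
    rw [Finset.sum_mul]
    refine Finset.sum_congr rfl fun x hx => ?_
    rw [Finset.mul_sum, Finset.sum_eq_single_of_mem x hx]
    · rw [D.b_mul_of_eq _ (hpow x hx n).symm, pow_succ]
    · intro y _ hy
      rw [b_mul, if_neg]
      intro h
      apply hy
      rw [← D.act_inv_eq_iff.mpr h, D.act_inv_eq_iff.mpr (hpow x hx n).symm]
  -- Only positive powers of the sum are available at first, since it is not a unit.
  have hsucc : ∀ n : ℕ, ∑ x ∈ D.fixSet O, D.b x (t x ^ (n + 1)) ∈ Y := by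
    intro n
    induction n with
    | zero => simpa using hz
    | succ n ih => rw [← hmul]; exact hY.mul_mem _ ih _ hz
  refine ⟨t, ht, fun n => ?_⟩
  have h1 := hsucc (n + (Fintype.card Q - 1))
  have h2 : n + (Fintype.card Q - 1) + 1 = n + Fintype.card Q := by
    have : 0 < Fintype.card Q := Fintype.card_pos
    omega
  rw [h2] at h1
  simpa only [pow_add, pow_card_eq_one, mul_one] using h1

/-- The stabiliser of a set whose idempotent lies in `Y` is an intersection of translates of that
set, and its idempotent is a product of slices. -/
lemma idem_stab_mem {T : Finset X} (hT : D.idem T ∈ Y) : D.idem (D.stab T) ∈ Y := by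
  have htr : ∀ β, D.idem (Finset.univ.filter fun α => D.comp α β ∈ T) ∈ Y := by
    intro β
    have hΔ : Coalgebra.comul (R := K) (D.idem T) =
        ∑ g ∈ T ×ˢ Finset.univ, D.b g.2 1 ⊗ₜ[K] D.b (D.quo g.2 g.1) 1 := by
      rw [Finset.sum_product, idem, map_sum]
      refine Finset.sum_congr rfl fun x _ => ?_
      rw [comul_b]
      simp_rw [tgt_at_one]
    have h1 := hY.comul_mem_tensorSquare hT
    rw [hΔ] at h1
    have h2 := D.sum_coef_smul_mem hY _ _ _ (fun g _ => D.b_mem_base _) h1 β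
    convert! h2 using 1
    rw [Finset.sum_product, Finset.sum_comm, idem, Finset.sum_filter]
    refine Finset.sum_congr rfl fun α _ => ?_
    simp_rw [coef_b, and_true, quo_eq_iff, ite_smul, one_smul, zero_smul]
    rw [Finset.sum_ite_eq']
  have hfin : ∀ s : Finset X,
      D.idem (Finset.univ.filter fun α => ∀ β ∈ s, D.comp α β ∈ T) ∈ Y := by
    intro s
    induction s using Finset.induction_on with
    | empty => simpa [idem_univ] using hY.one_mem
    | insert β s _ ih =>
      have := hY.mul_mem _ (htr β) _ ih
      rw [idem_mul_idem, ← Finset.filter_and] at this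
      simpa only [Finset.forall_mem_insert] using this
  exact hfin T

/-- Once the trivial idempotent is in `Y`, so are all its translates. -/
lemma b_one_mem_of_b_one_one_mem (h : D.b 1 1 ∈ Y) (x : X) : D.b x 1 ∈ Y := by
  have h1 := hY.comul_mem_tensorSquare h
  rw [comul_b] at h1
  simp_rw [tgt_at_one] at h1
  have h2 := D.sum_coef_smul_mem hY _ _ _ (fun g _ => D.b_mem_base _) h1 (D.quo x 1)
  rw [Finset.sum_eq_single x] at h2
  · simpa using h2
  · intro α _ hα
    rw [coef_b, if_neg, zero_smul]
    rintro ⟨h3, -⟩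
    apply hα
    rw [← D.quo_one_quo α, h3, quo_one_quo]
  · simp

/-- The idempotent `e` of the stabiliser of `fixSet O` separates the trivial idempotent: a loop `t`
at `x ∈ fixSet O` satisfies `e t e = b(1, t)`. -/
theorem b_one_mem [Fintype Q] {O : Finset Q} (hO : D.IsIsolating O) (x : X) : D.b x 1 ∈ Y := by
  obtain ⟨t, ht, hpow⟩ := D.exists_loops_mem hY hO
  set T := D.fixSet O with hT
  have hTmem : D.idem T ∈ Y := by simpa [idem] using hpow 0
  -- `e = idem A` acts on the left leg of the coproduct of the loops, and the inverses `z'` of the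
  -- loops on the right leg; what survives is `∑ b(1, t x) ⊗ b(x, 1)`.
  set A := D.stab T with hA
  have hAmem : D.idem A ∈ Y := D.idem_stab_mem hY hTmem
  set z := ∑ x ∈ T, D.b x (t x) with hz
  have hzmem : z ∈ Y := by simpa using hpow 1
  set z' := ∑ x ∈ T, D.b x (t x ^ (Fintype.card Q - 1)) with hz'
  have hz'mem : z' ∈ Y := hpow _
  have htt : ∀ q : Q, q * q ^ (Fintype.card Q - 1) = 1 := fun q => by
    rw [← pow_succ', Nat.sub_add_cancel Fintype.card_pos, pow_card_eq_one]
  have hw := hY.mul_mem_tensorSquare (hY.mul_mem_tensorSquare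
    (tmul_mem_tensorSquare (K := K) hAmem hY.one_mem) (hY.comul_mem_tensorSquare hzmem))
    (tmul_mem_tensorSquare hAmem hz'mem)
  have h1A : (1 : X) ∈ A := by simp [hA, stab]
  have hcalc : (D.idem A ⊗ₜ[K] 1) * Coalgebra.comul z * (D.idem A ⊗ₜ[K] z') =
      ∑ x ∈ T, D.b 1 (t x) ⊗ₜ[K] D.b x 1 := by
    rw [hz, map_sum, Finset.mul_sum, Finset.sum_mul]
    refine Finset.sum_congr rfl fun x hx => ?_
    rw [comul_b, Finset.mul_sum, Finset.sum_mul, Finset.sum_eq_single 1]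
    · rw [Algebra.TensorProduct.tmul_mul_tmul, Algebra.TensorProduct.tmul_mul_tmul, one_mul,
        idem_mul_b, if_pos h1A, b_mul_idem, map_one, if_pos h1A, quo_one_left, tgt_one]
      congr 1
      rw [hz', Finset.mul_sum, Finset.sum_eq_single_of_mem x hx]
      · rw [D.b_mul_of_eq _ (ht x hx).2.symm, htt]
      · intro y _ hy
        rw [b_mul, if_neg]
        intro h
        apply hy
        rw [← D.act_inv_eq_iff.mpr h, D.act_inv_eq_iff.mpr (ht x hx).2.symm]
    · -- the legs with `α ≠ 1` vanish since `A` lies in the kernel of `p`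
      intro α _ hα
      rw [Algebra.TensorProduct.tmul_mul_tmul, Algebra.TensorProduct.tmul_mul_tmul, idem_mul_b]
      by_cases h1 : α ∈ A
      · rw [if_pos h1, b_mul_idem, if_neg, TensorProduct.zero_tmul]
        intro h2
        exact hα (hO.ker _ (ht x hx).1 α (hO.p_eq_one_of_mem_stab h1)
          (hO.p_eq_one_of_mem_stab h2))
      · rw [if_neg h1, zero_mul, TensorProduct.zero_tmul]
    · simp
  rw [hcalc] at hw
  obtain ⟨q, hq, y, hy1, hqy⟩ := hO.exists_fix
  have hyT : y ∈ T := D.mem_fixSet.mpr ⟨hy1, q, hq, hqy⟩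
  have hslice := D.sum_coef_smul_mem hY _ _ _ (fun g _ => D.b_mem_base _) hw y
  rw [Finset.sum_eq_single_of_mem y hyT] at hslice
  swap
  · intro x _ hx
    rw [coef_b, if_neg, zero_smul]
    exact fun h => hx h.1
  rw [coef_b_self, one_smul] at hslice
  refine D.b_one_mem_of_b_one_one_mem hY ?_ x
  have hp : ∀ n : ℕ, D.b 1 (t y) ^ (n + 1) = D.b 1 (t y ^ (n + 1)) := by
    intro n
    induction n with
    | zero => simp
    | succ n ih => rw [pow_succ, ih, D.b_mul_of_eq _ (map_one _).symm, ← pow_succ]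
  have := hY.pow_mem hslice (Fintype.card Q - 1 + 1)
  rwa [hp, Nat.sub_add_cancel Fintype.card_pos, pow_card_eq_one] at this

end Base

end BismashBasis

/-! ### Determination of the Hopf order -/

namespace BismashBasis

variable {K X Q H : Type*} [Field K] [CommGroup X] [Fintype X] [DecidableEq X]
  [Group Q] [Ring H] [HopfAlgebra K H] (D : BismashBasis K X Q H)
  {R : Type*} [CommRing R] [Algebra R K] [Algebra R H] [IsScalarTower R K H]
  [IsIntegrallyClosed R] [IsFractionRing R K] {Y : Submodule R H} (hY : IsHopfOrder R K Y)

section Objects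

variable [Fintype Q] [DecidableEq Q]

/-- The functional `∑_{q ∈ S} b(1, q)^*`. -/
noncomputable def coefSum (S : Finset Q) : H →ₗ[K] K := ∑ q ∈ S, D.coef 1 q

omit [Fintype Q] in
lemma coefSum_b (S : Finset Q) (x : X) (q : Q) :
    D.coefSum S (D.b x q) = if x = 1 ∧ q ∈ S then 1 else 0 := by
  rw [coefSum, LinearMap.sum_apply]
  simp_rw [coef_b]
  by_cases h : x = 1
  · simp [h]
  · simp [h]

omit [Fintype Q] in
lemma convProd_coefSum (S T : Finset Q) :
    convProd (D.coefSum S) (D.coefSum T) = D.coefSum (S ∩ T) := by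
  refine D.basis.ext fun g => ?_
  obtain ⟨x, q⟩ := g
  change D.coefSum T (sliceL _ (Coalgebra.comul (D.b x q))) = D.coefSum (S ∩ T) (D.b x q)
  rw [sliceL_comul_b, Finset.sum_eq_single 1]
  · rw [quo_one_left, tgt_one, map_smul, coefSum_b, coefSum_b, coefSum_b]
    by_cases h1 : x = 1 <;> by_cases h2 : q ∈ S <;> by_cases h3 : q ∈ T <;> simp [h1, h2, h3]
  · intro α _ hα
    rw [coefSum_b, if_neg (fun h => hα h.1), zero_smul]
  · simp

omit [Fintype Q] [DecidableEq Q] in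
/-- The adjoint action of `b(1, q)` on `b(y, 1)` is the action of `q` on `y`. -/
lemma sandR_comul_b (y : X) (q : Q) :
    DrinfeldTwist.sandR (K := K) (D.b y 1) (Coalgebra.comul (R := K) (D.b 1 q)) =
      D.b (D.act q y) 1 := by
  rw [comul_b, map_sum, Finset.sum_eq_single (D.act q y)]
  · rw [DrinfeldTwist.sandR_tmul, D.b_mul_of_eq _ rfl, mul_one]
    have h := D.antipode' (D.quo (D.act q y) 1) (D.tgt (D.act q y) q)
    have h1 : D.act (D.tgt (D.act q y) q)⁻¹ (D.quo (D.act q y) 1) = D.act (D.p y) y⁻¹ := by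
      rw [act_tgt_inv, quo, act_inv_act, act_inv_act, mul_one, ← map_inv (D.act q), act_inv_act]
    have h2 : D.act (D.tgt (D.act q y) q)⁻¹ (D.quo (D.act q y) 1)⁻¹ = D.act (D.p y) y := by
      rw [map_inv, h1, map_inv, inv_inv]
    have h3 : D.act (D.p y)⁻¹ (D.act (D.p y) y) = y := D.act_inv_act _ _
    have h4 : (D.tgt (D.act q y) q)⁻¹ = D.p y * q⁻¹ * (D.p (D.act q y))⁻¹ := by
      rw [tgt, act_inv_act]; simp [mul_assoc]
    rw [h1, h2, p_act_p, map_inv D.p, h3, h4, p_quo, map_one, mul_one] at h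
    rw [b, b, h]
    have h5 : (D.p y)⁻¹ * (D.p y * q⁻¹ * (D.p (D.act q y))⁻¹) * (D.p (D.act q y))⁻¹⁻¹ = q⁻¹ := by
      group
    rw [h5, D.mul', if_pos rfl, mul_inv_cancel]
  · intro α _ hα
    rw [DrinfeldTwist.sandR_tmul, b_mul, if_neg hα, zero_mul]
  · simp

include hY in
/-- The functionals `∑ b(1, q)^*`, over the `q` that map `y` to `x`, are matrix coefficients of the
adjoint action on the span of the idempotents. -/
lemma coefSum_filter_mem (hb : ∀ x, D.b x 1 ∈ Y) (x y : X) :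
    D.coefSum (Finset.univ.filter fun q => D.act q y = x) ∈ dualLattice Y := by
  intro h hh
  have h1 : D.b 1 1 * h ∈ Y := hY.mul_mem _ (hb 1) _ hh
  have h2 : DrinfeldTwist.sandR (K := K) (D.b y 1) (Coalgebra.comul (R := K) (D.b 1 1 * h)) ∈ Y :=
    map_mem_of_mem_tensorSquare _ Y (fun a ha c hc => by
      rw [DrinfeldTwist.sandR_tmul]
      exact hY.mul_mem _ (hY.mul_mem _ ha _ (hb y)) _ (hY.antipode_mem _ hc))
      (hY.comul_mem_tensorSquare h1)
  rw [b_one_mul] at h2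
  simp_rw [map_sum, map_smul, sandR_comul_b] at h2
  have h3 := D.coef_mem_of_mem_base hY h2
    (Submodule.sum_mem _ fun q _ => Submodule.smul_mem _ _ (D.b_mem_base _)) x
  simp_rw [map_sum, map_smul, coef_b, and_true, smul_eq_mul, mul_ite, mul_one, mul_zero] at h3
  rw [← Finset.sum_filter] at h3
  simpa [coefSum] using h3

include hY in
/-- Convolving matrix coefficients isolates each group element, by faithfulness. -/
lemma coef_one_mem (hact : Function.Injective D.act) (hb : ∀ x, D.b x 1 ∈ Y) (q : Q) :
    D.coef 1 q ∈ dualLattice Y := by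
  have hfin : ∀ s : Finset X,
      D.coefSum (Finset.univ.filter fun r => ∀ y ∈ s, D.act r y = D.act q y) ∈ dualLattice Y := by
    intro s
    induction s using Finset.induction_on with
    | empty =>
      have : D.coefSum Finset.univ = Coalgebra.counit := by
        refine D.basis.ext fun g => ?_
        obtain ⟨x, r⟩ := g
        rw [D.counit']
        simpa using D.coefSum_b Finset.univ x r
      simpa [this] using hY.counit_mem_dualLattice
    | insert y s _ ih =>
      have := hY.convProd_mem (D.coefSum_filter_mem hY hb (D.act q y) y) ih
      rw [convProd_coefSum, ← Finset.filter_and] at this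
      simpa only [Finset.forall_mem_insert] using this
  have h1 := hfin Finset.univ
  have h2 : (Finset.univ.filter fun r => ∀ y ∈ (Finset.univ : Finset X), D.act r y = D.act q y) =
      {q} := by
    ext r
    simp only [Finset.mem_filter, Finset.mem_univ, true_and, true_implies,
      Finset.mem_singleton]
    exact ⟨fun h => hact (MulEquiv.ext h), fun h y => by rw [h]⟩
  rw [h2] at h1
  simpa [coefSum] using h1

include hY in
lemma b_one_left_mem (hact : Function.Injective D.act) (hb : ∀ x, D.b x 1 ∈ Y) (q : Q) :
    D.b 1 q ∈ Y := by
  have h1 := hY.mul_mem _ (hb 1) _ (D.sum_loops_mem hY Finset.univ (fun _ _ _ => Finset.mem_univ _))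
  have h2 : D.b 1 1 * ∑ q, ∑ α, (if D.tgt α q = q then D.b α q else 0) = ∑ q, D.b 1 q := by
    rw [Finset.mul_sum]
    refine Finset.sum_congr rfl fun r _ => ?_
    rw [Finset.mul_sum, Finset.sum_eq_single 1]
    · rw [tgt_one, if_pos rfl, D.b_mul_of_eq _ (map_one _).symm, one_mul]
    · intro α _ hα
      split_ifs
      · rw [b_mul, act_one, if_neg hα.symm]
      · rw [mul_zero]
    · simp
  rw [h2] at h1
  have h3 := sliceL_mem (D.coef_one_mem hY hact hb q) (hY.comul_mem_tensorSquare h1)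
  rw [sliceL_coef_comul, Finset.sum_eq_single 1] at h3
  · rw [map_sum, Finset.sum_eq_single q] at h3
    · simpa using h3
    · intro r _ hr
      rw [coef_b, if_neg (fun h => hr h.2)]
    · simp
  · intro x _ hx
    rw [map_sum, Finset.sum_eq_zero, zero_smul]
    intro r _
    rw [coef_b, if_neg (fun h => hx h.1.symm)]
  · simp

include hY in
/-- `Y` is graded by the lines spanned by the basis elements. -/
lemma coef_smul_mem (hact : Function.Injective D.act) (hb : ∀ x, D.b x 1 ∈ Y) {y : H}
    (hy : y ∈ Y) (x : X) (q : Q) : D.coef x q y • D.b x q ∈ Y := by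
  have h1 := sliceL_mem (D.coef_one_mem hY hact hb q) (hY.comul_mem_tensorSquare hy)
  rw [sliceL_coef_comul] at h1
  have h2 := hY.mul_mem _ (hb x) _ h1
  rw [Finset.mul_sum, Finset.sum_eq_single x] at h2
  · rwa [mul_smul_comm, D.b_mul_of_eq _ (D.act_one x).symm, one_mul] at h2
  · intro z _ hz
    rw [mul_smul_comm, b_mul, act_one, if_neg hz.symm, smul_zero]
  · simp

end Objects

/-! ### The coefficient ideals -/

section Ideals

/-- The fractional ideal of all `a` with `a b(x, q) ∈ Y`. -/
noncomputable def coefIdeal (Y : Submodule R H) (x : X) (q : Q) : Submodule R K :=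
  Y.comap ((LinearMap.toSpanSingleton K H (D.b x q)).restrictScalars R)

omit [IsIntegrallyClosed R] [IsFractionRing R K] in
lemma mem_coefIdeal {x : X} {q : Q} {a : K} : a ∈ D.coefIdeal Y x q ↔ a • D.b x q ∈ Y := by
  simp [coefIdeal]

omit [IsFractionRing R K] in
lemma _root_.Submodule.le_one_of_pow_le_one [IsFractionRing R K] {I : Submodule R K} {n : ℕ} (hn : 0 < n)
    (h : I ^ n ≤ 1) : I ≤ 1 := by
  intro a ha
  have h1 : a ^ n ∈ (1 : Submodule R K) := h (Submodule.pow_mem_pow I ha n)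
  obtain ⟨r, hr⟩ := Submodule.mem_one.mp h1
  refine Submodule.mem_one_of_isIntegral (IsIntegral.of_pow hn ?_)
  rw [← hr]
  exact isIntegral_algebraMap

include hY

omit [IsIntegrallyClosed R] [IsFractionRing R K] in
lemma coefIdeal_mul_le (x : X) (q r : Q) :
    D.coefIdeal Y x q * D.coefIdeal Y (D.act q⁻¹ x) r ≤ D.coefIdeal Y x (q * r) := by
  refine Submodule.mul_le.mpr fun a ha c hc => ?_
  rw [mem_coefIdeal] at *
  have := hY.mul_mem _ ha _ hc
  rwa [smul_mul_smul_comm, D.b_mul_of_eq _ (D.act_act_inv q x).symm] at this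

lemma coefIdeal_at_one (hb : ∀ x, D.b x 1 ∈ Y) (x : X) : D.coefIdeal Y x 1 = 1 := by
  classical
  refine le_antisymm (fun a ha => ?_) (Submodule.one_le.mpr ?_)
  · have := D.coef_mem_of_mem_base hY (D.mem_coefIdeal.mp ha)
      (Submodule.smul_mem _ _ (D.b_mem_base x)) x
    simpa using this
  · rw [mem_coefIdeal, one_smul]
    exact hb x

/-- The antipode exchanges the lines of `b(α, q)` and of its inverse for both compositions. -/
lemma coefIdeal_mul_inverse_le (hb : ∀ x, D.b x 1 ∈ Y) (α : X) (q : Q) :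
    D.coefIdeal Y α q * D.coefIdeal Y (D.quo α 1) (D.tgt α q) ≤ 1 := by
  have hle : D.coefIdeal Y α q ≤
      D.coefIdeal Y (D.act (D.tgt α q)⁻¹ (D.quo α 1)) (D.tgt α q)⁻¹ := by
    intro a ha
    rw [mem_coefIdeal] at *
    have h := hY.antipode_mem _ ha
    rw [map_smul, b, D.antipode'] at h
    have e1 : D.act (D.tgt α q)⁻¹ (D.quo α 1) = D.act (D.p (D.act q⁻¹ α)) (D.act q⁻¹ α⁻¹) := by
      rw [act_tgt_inv, quo, mul_one, act_inv_act]
    have e2 : (D.tgt α q)⁻¹ = D.p (D.act q⁻¹ α) * q⁻¹ * (D.p α)⁻¹ := by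
      rw [tgt, mul_inv_rev, mul_inv_rev, inv_inv, mul_assoc]
    rwa [b, e1, e2]
  rw [mul_comm]
  refine (mul_le_mul_right hle _).trans ((D.coefIdeal_mul_le hY _ _ _).trans ?_)
  rw [mul_inv_cancel, D.coefIdeal_at_one hY hb]

variable [Fintype Q] [DecidableEq Q] (hact : Function.Injective D.act) (hb : ∀ x, D.b x 1 ∈ Y)
include hact hb

lemma coefIdeal_le_mul (α x : X) (q : Q) :
    D.coefIdeal Y x q ≤ D.coefIdeal Y α q * D.coefIdeal Y (D.quo α x) (D.tgt α q) := by
  intro a ha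
  rw [mem_coefIdeal] at ha
  have h1 := map_mem_of_mem_tensorSquare
    (LinearMap.mul' K K ∘ₗ TensorProduct.map (D.coef α q) (D.coef (D.quo α x) (D.tgt α q)))
    (D.coefIdeal Y α q * D.coefIdeal Y (D.quo α x) (D.tgt α q)) (fun u hu v hv => by
      simp only [LinearMap.comp_apply, TensorProduct.map_tmul, LinearMap.mul'_apply]
      exact Submodule.mul_mem_mul (D.mem_coefIdeal.mpr (D.coef_smul_mem hY hact hb hu _ _))
        (D.mem_coefIdeal.mpr (D.coef_smul_mem hY hact hb hv _ _)))
    (hY.comul_mem_tensorSquare ha)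
  rw [map_smul, comul_b, map_smul, map_sum, Finset.sum_eq_single α] at h1
  · simpa only [LinearMap.comp_apply, TensorProduct.map_tmul, LinearMap.mul'_apply, coef_b_self,
      mul_one, smul_eq_mul] using h1
  · intro β _ hβ
    simp only [LinearMap.comp_apply, TensorProduct.map_tmul, LinearMap.mul'_apply]
    rw [coef_b, if_neg (fun h => hβ h.1), zero_mul]
  · simp

lemma coefIdeal_mul_inverse (α : X) (q : Q) :
    D.coefIdeal Y α q * D.coefIdeal Y (D.quo α 1) (D.tgt α q) = 1 := by
  refine le_antisymm (D.coefIdeal_mul_inverse_le hY hb α q) ?_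
  refine le_trans (Submodule.one_le.mpr ?_) (D.coefIdeal_le_mul hY hact hb α 1 q)
  rw [mem_coefIdeal, one_smul]
  exact D.b_one_left_mem hY hact hb q

lemma coefIdeal_mul_le_comp (α β : X) (q : Q) :
    D.coefIdeal Y α q * D.coefIdeal Y β (D.tgt α q) ≤ D.coefIdeal Y (D.comp α β) q := by
  have h1 := D.coefIdeal_le_mul hY hact hb (D.quo α 1) β (D.tgt α q)
  rw [tgt_inverse] at h1
  have h2 : D.quo (D.quo α 1) β = D.comp α β := by simp [quo, comp]
  rw [h2] at h1
  calc _ ≤ D.coefIdeal Y α q * (D.coefIdeal Y (D.quo α 1) (D.tgt α q) *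
        D.coefIdeal Y (D.comp α β) q) := mul_le_mul_right h1 _
    _ = _ := by rw [← mul_assoc, D.coefIdeal_mul_inverse hY hact hb, one_mul]

omit hact [DecidableEq Q] in
/-- The product over `X` is submultiplicative in `q`, and `Q` is finite. -/
lemma prod_coefIdeal_le_one (q : Q) : ∏ x, D.coefIdeal Y x q ≤ 1 := by
  have hpow : ∀ n : ℕ, (∏ x, D.coefIdeal Y x q) ^ n ≤ ∏ x, D.coefIdeal Y x (q ^ n) := by
    intro n
    induction n with
    | zero => simp [D.coefIdeal_at_one hY hb]
    | succ n ih =>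
      rw [pow_succ]
      refine (mul_le_mul_left ih _).trans ?_
      rw [← Equiv.prod_comp (D.act (q ^ n)⁻¹).toEquiv (fun x => D.coefIdeal Y x q),
        ← Finset.prod_mul_distrib]
      refine Finset.prod_le_prod' fun x _ => ?_
      rw [pow_succ]
      exact D.coefIdeal_mul_le hY x (q ^ n) q
  refine Submodule.le_one_of_pow_le_one Fintype.card_pos ((hpow (Fintype.card Q)).trans ?_)
  rw [pow_card_eq_one]
  simp [D.coefIdeal_at_one hY hb]

/-- The product over all arrows is its own inverse, because inversion permutes the arrows. -/
lemma prod_coefIdeal_eq_one (q : Q) : ∏ x, D.coefIdeal Y x q = 1 := by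
  set F : Q → Submodule R K := fun q => ∏ x, D.coefIdeal Y x q with hF
  have hle : ∀ q, F q ≤ 1 := D.prod_coefIdeal_le_one hY hb
  have hinv : ∏ q, F q = ∏ g : Q × X, D.coefIdeal Y (D.quo g.2 1) (D.tgt g.2 g.1) := by
    rw [hF, ← Fintype.prod_prod_type']
    refine Finset.prod_nbij' (fun g => (D.tgt g.2 g.1, D.quo g.2 1))
      (fun g => (D.tgt g.2 g.1, D.quo g.2 1)) ?_ ?_ ?_ ?_ ?_ <;> simp [tgt_inverse]
  have hsq : (∏ q, F q) * ∏ q, F q = 1 := by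
    conv_lhs => arg 2; rw [hinv]
    rw [hF, ← Fintype.prod_prod_type', ← Finset.prod_mul_distrib]
    exact Finset.prod_eq_one fun g _ => D.coefIdeal_mul_inverse hY hact hb g.2 g.1
  have hall : ∏ q, F q ≤ 1 := Finset.prod_le_one' fun q _ => hle q
  refine le_antisymm (hle q) ?_
  calc (1 : Submodule R K) = (∏ q, F q) * ∏ q, F q := hsq.symm
    _ ≤ (∏ q, F q) * 1 := mul_le_mul_right hall _
    _ = F q * ∏ r ∈ Finset.univ.erase q, F r := by
      rw [mul_one, Finset.mul_prod_erase _ _ (Finset.mem_univ q)]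
    _ ≤ F q * 1 := mul_le_mul_right (Finset.prod_le_one' fun q _ => hle q) _
    _ = F q := mul_one _

lemma coefIdeal_le_one (α : X) (q : Q) : D.coefIdeal Y α q ≤ 1 := by
  refine Submodule.le_one_of_pow_le_one (n := Fintype.card X) Fintype.card_pos ?_
  have h1 : D.coefIdeal Y α q ^ Fintype.card X * ∏ β, D.coefIdeal Y β (D.tgt α q) ≤
      ∏ β, D.coefIdeal Y β q := by
    rw [← Equiv.prod_comp (D.compEquiv α) (fun x => D.coefIdeal Y x q), ← Finset.card_univ,
      ← Finset.prod_const, ← Finset.prod_mul_distrib]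
    exact Finset.prod_le_prod' fun β _ => D.coefIdeal_mul_le_comp hY hact hb α β q
  rwa [D.prod_coefIdeal_eq_one hY hact hb, D.prod_coefIdeal_eq_one hY hact hb, mul_one] at h1

lemma coefIdeal_eq_one (α : X) (q : Q) : D.coefIdeal Y α q = 1 := by
  refine le_antisymm (D.coefIdeal_le_one hY hact hb α q) ?_
  rw [← D.coefIdeal_mul_inverse hY hact hb α q]
  exact (mul_le_mul_right (D.coefIdeal_le_one hY hact hb _ _) _).trans_eq (mul_one _)

end Ideals

/-- A Hopf order containing the idempotents `b(x, 1)` is spanned by the basis. -/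
theorem eq_span_of_b_one_mem [Fintype Q] [DecidableEq Q] (hY : IsHopfOrder R K Y)
    (hact : Function.Injective D.act) (hb : ∀ x, D.b x 1 ∈ Y) :
    Y = Submodule.span R (Set.range D.basis) := by
  refine le_antisymm (fun y hy => ?_) (Submodule.span_le.mpr ?_)
  · rw [D.eq_sum y]
    refine Submodule.sum_mem _ fun x _ => Submodule.sum_mem _ fun q _ => ?_
    have h : D.coef x q y ∈ (1 : Submodule R K) := by
      rw [← D.coefIdeal_eq_one hY hact hb x q]
      exact D.mem_coefIdeal.mpr (D.coef_smul_mem hY hact hb hy x q)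
    exact smul_mem_of_mem_one _ h (Submodule.subset_span ⟨_, rfl⟩)
  · rintro _ ⟨⟨x, q⟩, rfl⟩
    have h : (1 : K) ∈ D.coefIdeal Y x q := by
      rw [D.coefIdeal_eq_one hY hact hb]
      exact Submodule.one_le.mp le_rfl
    rw [mem_coefIdeal, one_smul] at h
    exact h

/-! ### The span of the basis is a Hopf order -/

omit [IsIntegrallyClosed R] in
lemma isHopfOrder_span [Finite Q] :
    IsHopfOrder R K (Submodule.span R (Set.range D.basis)) := by
  classical
  have := Fintype.ofFinite Q
  have : IsDomain R := (FaithfulSMul.algebraMap_injective R K).isDomain _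
  have hmem : ∀ x q, D.b x q ∈ Submodule.span R (Set.range D.basis) := fun x q =>
    Submodule.subset_span ⟨_, rfl⟩
  let c : Module.Basis (X × Q) R (Submodule.span R (Set.range D.basis)) :=
    D.basis.restrictScalars R
  refine ⟨Module.Finite.of_basis c, Module.Projective.of_basis c, ?_, ?_, ?_, ?_, ?_, ?_⟩
  · have h := (IsBaseChange.of_fintype_basis (A := R) D.basis).comp_equiv c.equivFun
    convert! h using 1
    refine c.ext fun g => ?_
    simp [c, Fintype.linearCombination_apply, Finsupp.single_apply]
  · rw [D.one']
    exact Submodule.sum_mem _ fun x _ => hmem x 1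
  · intro a ha d hd
    have : a * d ∈ Submodule.span R (Set.range D.basis) * Submodule.span R (Set.range D.basis) :=
      Submodule.mul_mem_mul ha hd
    rw [Submodule.span_mul_span] at this
    refine Submodule.span_le.mpr ?_ this
    rintro _ ⟨_, ⟨⟨x, q⟩, rfl⟩, _, ⟨⟨y, r⟩, rfl⟩, rfl⟩
    dsimp only
    rw [D.mul']
    split_ifs
    · exact hmem _ _
    · exact Submodule.zero_mem _
  · intro a ha
    suffices h : Submodule.span R (Set.range D.basis) ≤
        (tensorSquare K (Submodule.span R (Set.range D.basis))).comap
          ((Coalgebra.comul (R := K) (A := H)).restrictScalars R) from h ha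
    refine Submodule.span_le.mpr ?_
    rintro _ ⟨⟨x, q⟩, rfl⟩
    rw [SetLike.mem_coe, Submodule.mem_comap, LinearMap.restrictScalars_apply, D.comul_b]
    exact Submodule.sum_mem _ fun α _ => tmul_mem_tensorSquare (hmem _ _) (hmem _ _)
  · intro a ha
    suffices h : Submodule.span R (Set.range D.basis) ≤
        (1 : Submodule R K).comap ((Coalgebra.counit (R := K) (A := H)).restrictScalars R) from
      Submodule.mem_one.mp (h ha)
    refine Submodule.span_le.mpr ?_
    rintro _ ⟨⟨x, q⟩, rfl⟩
    rw [SetLike.mem_coe, Submodule.mem_comap, LinearMap.restrictScalars_apply, D.counit']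
    split_ifs
    · exact Submodule.one_le.mp le_rfl
    · exact Submodule.zero_mem _
  · intro a ha
    suffices h : Submodule.span R (Set.range D.basis) ≤
        (Submodule.span R (Set.range D.basis)).comap
          ((HopfAlgebra.antipode K (A := H)).restrictScalars R) from h ha
    refine Submodule.span_le.mpr ?_
    rintro _ ⟨⟨x, q⟩, rfl⟩
    rw [SetLike.mem_coe, Submodule.mem_comap, LinearMap.restrictScalars_apply, D.antipode']
    exact hmem _ _

end BismashBasis

/-! ### Idempotents and restriction of characters -/

section CharIdem

attribute [local instance] Fintype.ofFinite

variable {K A B G : Type*} [Field K] [CharZero K] [Group A] [Finite A] [Group B] [Finite B]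
  [Group G] (i : A →* G)

lemma charIdem_comp_mul_charIdem (j : B →* A) (l : B →* Kˣ) (φ : A →* Kˣ)
    [Decidable (φ.comp j = l)] :
    charIdem (K := K) (i.comp j) l * charIdem i φ = if φ.comp j = l then charIdem i φ else 0 := by
  have hB : (Nat.card B : K) ≠ 0 := by exact_mod_cast Nat.card_pos.ne'
  have h1 : charIdem (K := K) (i.comp j) l * charIdem i φ =
      ((Nat.card B : K)⁻¹ * ∑ a : B, (((l⁻¹ * φ.comp j) a : Kˣ) : K)) • charIdem i φ := by
    conv_lhs => rw [charIdem]
    rw [smul_mul_assoc, Finset.sum_mul, mul_smul, Finset.sum_smul]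
    congr 1
    refine Finset.sum_congr rfl fun a _ => ?_
    have : (MonoidAlgebra.single ((i.comp j) a) ((l a⁻¹ : Kˣ) : K)) =
        ((l a⁻¹ : Kˣ) : K) • MonoidAlgebra.single (i (j a)) (1 : K) := by
      simp [MonoidAlgebra.smul_single]
    rw [this, smul_mul_assoc, single_mul_charIdem, smul_smul]
    simp
  rw [h1]
  split_ifs with h
  · subst h
    simp [← Nat.card_eq_fintype_card, hB]
  · have h3 := sum_hom_units_eq_zero (R := K) ((Units.coeHom K).comp (l⁻¹ * φ.comp j)) (by
      intro h0
      apply h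
      ext a
      have h4 := DFunLike.congr_fun h0 a
      simp only [MonoidHom.comp_apply, Units.coeHom_apply, MonoidHom.one_apply,
        Units.val_eq_one, MonoidHom.mul_apply, MonoidHom.inv_apply] at h4
      rw [MonoidHom.comp_apply, inv_mul_eq_one.mp h4])
    simp only [MonoidHom.comp_apply, Units.coeHom_apply] at h3
    simp only [h3, mul_zero, zero_smul]

variable [IsMulCommutative A] [HasEnoughRootsOfUnity K (Monoid.exponent A)]

/-- The idempotent of a character of a subgroup is the sum of the idempotents of its extensions. -/
lemma charIdem_comp_eq_sum (j : B →* A) (l : B →* Kˣ) [DecidablePred fun φ : A →* Kˣ => φ.comp j = l] :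
    charIdem (K := K) (i.comp j) l =
      ∑ φ : A →* Kˣ, if φ.comp j = l then charIdem i φ else 0 := by
  conv_lhs => rw [← mul_one (charIdem _ l), ← sum_charIdem (K := K) i, Finset.mul_sum]
  exact Finset.sum_congr rfl fun φ _ => charIdem_comp_mul_charIdem i j l φ

lemma sum_charIdem_tmul_comp {M : Type*} [AddCommGroup M] [Module K M] (j : B →* A)
    (g : (B →* Kˣ) → M) :
    ∑ φ : A →* Kˣ, charIdem i φ ⊗ₜ[K] g (φ.comp j) =
      ∑ l : B →* Kˣ, charIdem (K := K) (i.comp j) l ⊗ₜ[K] g l := by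
  classical
  simp_rw [charIdem_comp_eq_sum, TensorProduct.sum_tmul]
  rw [Finset.sum_comm]
  refine Finset.sum_congr rfl fun φ _ => ?_
  rw [Finset.sum_eq_single (φ.comp j)]
  · rw [if_pos rfl]
  · intro l _ hl
    rw [if_neg hl.symm, TensorProduct.zero_tmul]
  · simp

omit [CharZero K] [IsMulCommutative A] [HasEnoughRootsOfUnity K (Monoid.exponent A)] in
lemma antipode_charIdem (φ : A →* Kˣ) :
    HopfAlgebra.antipode K (charIdem (K := K) i φ) = charIdem i φ⁻¹ := by
  unfold charIdem
  rw [map_smul, map_sum]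
  congr 1
  refine Fintype.sum_equiv (Equiv.inv A) _ _ fun a => ?_
  rw [MonoidAlgebra.antipode_single]
  simp

end CharIdem

/-! ### The basis of the twisted group algebra -/

section Semidirect

attribute [local instance] Fintype.ofFinite

variable {K N Q : Type*} [Field K] [CommGroup N] [Group Q]

/-- The action of `Q` on `N̂`. -/
def charAct (K : Type*) {N Q : Type*} [Field K] [CommGroup N] [Group Q] (θ : Q →* MulAut N) :
    Q →* MulAut (N →* Kˣ) where
  toFun q :=
    { toFun := fun ν => ν.comp (θ q⁻¹).toMonoidHom
      invFun := fun ν => ν.comp (θ q).toMonoidHom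
      left_inv := fun ν => by ext n; simp
      right_inv := fun ν => by ext n; simp
      map_mul' := fun ν μ => rfl }
  map_one' := by ext ν n; simp
  map_mul' q r := by ext ν n; simp

variable {θ : Q →* MulAut N}

lemma charAct_apply (q : Q) (ν : N →* Kˣ) (n : N) : charAct K θ q ν n = ν (θ q⁻¹ n) := rfl

/-- The homomorphism `N̂ → L̂ → P ≤ Q`. -/
def charToQ {L : Subgroup N} {P : Subgroup Q} (f : P ≃* (L →* Kˣ)) : (N →* Kˣ) →* Q :=
  P.subtype.comp (f.symm.toMonoidHom.comp
    { toFun := fun ν => ν.comp L.subtype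
      map_one' := rfl
      map_mul' := fun _ _ => rfl })

lemma charToQ_apply {L : Subgroup N} {P : Subgroup Q} (f : P ≃* (L →* Kˣ)) (ν : N →* Kˣ) :
    charToQ f ν = f.symm (ν.comp L.subtype) := rfl

lemma charToQ_mem {L : Subgroup N} {P : Subgroup Q} (f : P ≃* (L →* Kˣ)) (ν : N →* Kˣ) :
    charToQ f ν ∈ P := (f.symm (ν.comp L.subtype)).2

lemma charToQ_eq_one_iff {L : Subgroup N} {P : Subgroup Q} (f : P ≃* (L →* Kˣ)) (ν : N →* Kˣ) :
    charToQ f ν = 1 ↔ ∀ l ∈ L, ν l = 1 := by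
  rw [charToQ_apply, OneMemClass.coe_eq_one, EmbeddingLike.map_eq_one_iff]
  exact ⟨fun h l hl => DFunLike.congr_fun h ⟨l, hl⟩, fun h => MonoidHom.ext fun l => h l l.2⟩

lemma act_eq_of_commute {L : Subgroup N} {P : Subgroup Q}
    (hLP : ∀ l ∈ L, ∀ σ ∈ P, Commute (SemidirectProduct.inl l : N ⋊[θ] Q)
      (SemidirectProduct.inr σ)) {l : N} (hl : l ∈ L) {σ : Q} (hσ : σ ∈ P) : θ σ l = l := by
  have h := hLP l hl σ hσ
  have h1 := SemidirectProduct.inl_aut (φ := θ) σ l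
  rw [← h.eq, mul_assoc, ← map_mul, mul_inv_cancel, map_one, mul_one] at h1
  exact SemidirectProduct.inl_injective h1

lemma charToQ_charAct {L : Subgroup N} {P : Subgroup Q}
    (hLP : ∀ l ∈ L, ∀ σ ∈ P, Commute (SemidirectProduct.inl l : N ⋊[θ] Q)
      (SemidirectProduct.inr σ)) (f : P ≃* (L →* Kˣ)) {σ : Q} (hσ : σ ∈ P) (ν : N →* Kˣ) :
    charToQ f (charAct K θ σ ν) = charToQ f ν := by
  rw [charToQ_apply, charToQ_apply]
  congr 2
  ext l
  change ((ν (θ σ⁻¹ l) : Kˣ) : K) = ν l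
  rw [act_eq_of_commute hLP l.2 (inv_mem hσ)]

variable [Finite N]

/-- The element `e_ν q` of `K(N ⋊ Q)`. -/
noncomputable def idemMul (K : Type*) {N Q : Type*} [Field K] [CommGroup N] [Group Q] [Finite N]
    (θ : Q →* MulAut N) (ν : N →* Kˣ) (q : Q) : MonoidAlgebra K (N ⋊[θ] Q) :=
  charIdem SemidirectProduct.inl ν * MonoidAlgebra.single (SemidirectProduct.inr q) 1

lemma single_inr_mul_charIdem (q : Q) (ν : N →* Kˣ) :
    MonoidAlgebra.single (SemidirectProduct.inr q : N ⋊[θ] Q) (1 : K) *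
      charIdem SemidirectProduct.inl ν = idemMul K θ (charAct K θ q ν) q := by
  unfold idemMul charIdem
  rw [mul_smul_comm, smul_mul_assoc, Finset.mul_sum, Finset.sum_mul]
  congr 1
  refine Fintype.sum_equiv (θ q).toEquiv _ _ fun n => ?_
  rw [MonoidAlgebra.single_mul_single, MonoidAlgebra.single_mul_single, one_mul, mul_one]
  have h : (SemidirectProduct.inr q : N ⋊[θ] Q) * SemidirectProduct.inl n =
      SemidirectProduct.inl (θ q n) * SemidirectProduct.inr q := by
    rw [SemidirectProduct.inl_aut, mul_assoc, ← map_mul, inv_mul_cancel, map_one, mul_one]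
  rw [h]
  simp [charAct_apply]

lemma idemMul_mul_single (ν : N →* Kˣ) (q r : Q) :
    idemMul K θ ν q * MonoidAlgebra.single (SemidirectProduct.inr r) 1 =
      idemMul K θ ν (q * r) := by
  rw [idemMul, mul_assoc, MonoidAlgebra.single_mul_single, ← map_mul, one_mul, idemMul]

lemma single_mul_idemMul (ν : N →* Kˣ) (q r : Q) :
    MonoidAlgebra.single (SemidirectProduct.inr r) 1 * idemMul K θ ν q =
      idemMul K θ (charAct K θ r ν) (r * q) := by
  rw [idemMul, ← mul_assoc, single_inr_mul_charIdem, idemMul_mul_single]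

variable [CharZero K]

lemma idemMul_mul [DecidableEq (N →* Kˣ)] (ν : N →* Kˣ) (q : Q) (μ : N →* Kˣ) (r : Q) :
    idemMul K θ ν q * idemMul K θ μ r =
      if ν = charAct K θ q μ then idemMul K θ ν (q * r) else 0 := by
  conv_lhs => rw [idemMul, mul_assoc, single_mul_idemMul, idemMul, ← mul_assoc, charIdem_mul]
  split_ifs
  · rfl
  · rw [zero_mul]

lemma charIdem_mul_idemMul [DecidableEq (N →* Kˣ)] (ν : N →* Kˣ) (μ : N →* Kˣ) (r : Q) :
    charIdem SemidirectProduct.inl ν * idemMul K θ μ r =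
      if ν = μ then idemMul K θ μ r else 0 := by
  conv_lhs => rw [idemMul, ← mul_assoc, charIdem_mul]
  split_ifs with h
  · rw [h]; rfl
  · rw [zero_mul]

lemma idemMul_mul_charIdem [DecidableEq (N →* Kˣ)] (ν : N →* Kˣ) (μ : N →* Kˣ) (q : Q) :
    idemMul K θ ν q * charIdem SemidirectProduct.inl μ =
      if charAct K θ q⁻¹ ν = μ then idemMul K θ ν q else 0 := by
  have h : (charIdem SemidirectProduct.inl μ : MonoidAlgebra K (N ⋊[θ] Q)) = idemMul K θ μ 1 := by
    rw [idemMul, map_one, ← MonoidAlgebra.one_def, mul_one]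
  rw [h, idemMul_mul, mul_one]
  congr 1
  rw [map_inv, eq_iff_iff]
  exact (MulEquiv.symm_apply_eq _).symm

variable [HasEnoughRootsOfUnity K (Monoid.exponent N)]

lemma sum_idemMul (q : Q) : ∑ ν : N →* Kˣ, idemMul K θ ν q =
    MonoidAlgebra.single (SemidirectProduct.inr q) 1 := by
  simp_rw [idemMul, ← Finset.sum_mul]
  rw [sum_charIdem, one_mul]

lemma comul_idemMul (ν : N →* Kˣ) (q : Q) :
    Coalgebra.comul (R := K) (idemMul K θ ν q) =
      ∑ η : N →* Kˣ, idemMul K θ η q ⊗ₜ[K] idemMul K θ (η⁻¹ * ν) q := by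
  rw [idemMul, Bialgebra.comul_mul, comul_charIdem, MonoidAlgebra.comul_single, Finset.sum_mul]
  refine Finset.sum_congr rfl fun η _ => ?_
  simp [idemMul]

/-- The elements `e_ν q` form a basis of `K(N ⋊ Q)`. -/
noncomputable def idemBasis (K : Type*) {N Q : Type*} [Field K] [CommGroup N] [Group Q] [Finite N]
    [CharZero K] [HasEnoughRootsOfUnity K (Monoid.exponent N)] [Finite Q] (θ : Q →* MulAut N) :
    Module.Basis ((N →* Kˣ) × Q) K (MonoidAlgebra K (N ⋊[θ] Q)) :=
  haveI : Finite (N ⋊[θ] Q) := Finite.of_equiv _ SemidirectProduct.equivProd.symm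
  basisOfTopLeSpanOfCardEqFinrank (fun g => idemMul K θ g.1 g.2)
    (by
      rw [← (MonoidAlgebra.basis (N ⋊[θ] Q) K).span_eq]
      refine Submodule.span_le.mpr ?_
      rintro _ ⟨g, rfl⟩
      have h1 : MonoidAlgebra.basis (N ⋊[θ] Q) K g =
          MonoidAlgebra.single (SemidirectProduct.inl g.left) 1 *
            MonoidAlgebra.single (SemidirectProduct.inr g.right) 1 := by
        rw [MonoidAlgebra.single_mul_single, SemidirectProduct.inl_left_mul_inr_right, mul_one]
        simp
      rw [h1, ← sum_char_smul_charIdem (K := K), Finset.sum_mul]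
      refine Submodule.sum_mem _ fun ν _ => ?_
      rw [smul_mul_assoc]
      exact Submodule.smul_mem _ _ (Submodule.subset_span ⟨(ν, g.right), rfl⟩))
    (by
      rw [Module.finrank_eq_card_basis (MonoidAlgebra.basis (N ⋊[θ] Q) K),
        ← Nat.card_eq_fintype_card, ← Nat.card_eq_fintype_card,
        Nat.card_congr (SemidirectProduct.equivProd (φ := θ)), Nat.card_prod, Nat.card_prod,
        CommGroup.card_monoidHom_of_hasEnoughRootsOfUnity])

lemma idemBasis_apply [Finite Q] (ν : N →* Kˣ) (q : Q) :
    idemBasis K θ (ν, q) = idemMul K θ ν q := by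
  simp [idemBasis]

variable [Finite Q] {L : Subgroup N} {P : Subgroup Q} [IsMulCommutative P]
  (hLP : ∀ l ∈ L, ∀ σ ∈ P, Commute (SemidirectProduct.inl l : N ⋊[θ] Q)
      (SemidirectProduct.inr σ)) (f : P ≃* (L →* Kˣ))

/-- Summing over the characters of `P` turns the twist into `∑ e_ν ⊗ p(ν)`. -/
lemma twistOfIso_val : ((twistOfIso hLP f).val : MonoidAlgebra K (N ⋊[θ] Q) ⊗[K] MonoidAlgebra K (N ⋊[θ] Q)) =
    ∑ ν : N →* Kˣ, charIdem (K := K) (SemidirectProduct.inl : N →* N ⋊[θ] Q) ν ⊗ₜ[K]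
      MonoidAlgebra.single (SemidirectProduct.inr (charToQ f ν) : N ⋊[θ] Q) (1 : K) := by
  have : Finite (N ⋊[θ] Q) := Finite.of_equiv _ SemidirectProduct.equivProd.symm
  have := subgroupLP_isMulCommutative hLP
  have := subgroupLP_hasEnoughRoots (θ := θ) f
  set M := subgroupLP θ L P
  let g : (L →* Kˣ) → MonoidAlgebra K (N ⋊[θ] Q) := fun l =>
    MonoidAlgebra.single (SemidirectProduct.inr (f.symm l : Q)) 1
  have h1 : ((twistOfIso hLP f).val : MonoidAlgebra K (N ⋊[θ] Q) ⊗[K] MonoidAlgebra K (N ⋊[θ] Q)) =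
      ∑ φ : M →* Kˣ, charIdem M.subtype φ ⊗ₜ[K] g (φ.comp (inclL θ L P)) := by
    change ∑ φ : M →* Kˣ, ∑ ψ : M →* Kˣ, (cocycleOfIso f φ ψ : K) •
      (charIdem M.subtype φ ⊗ₜ[K] charIdem M.subtype ψ) = _
    refine Finset.sum_congr rfl fun φ _ => ?_
    simp_rw [← TensorProduct.tmul_smul, ← TensorProduct.tmul_sum]
    congr 1
    exact sum_char_smul_charIdem (K := K) M.subtype (inclP θ L P (f.symm (φ.comp (inclL θ L P))))
  rw [h1, sum_charIdem_tmul_comp]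
  exact (sum_charIdem_tmul_comp (K := K) (SemidirectProduct.inl : N →* N ⋊[θ] Q) L.subtype g).symm

lemma twistOfIso_inv : (↑(twistOfIso hLP f).val⁻¹ : MonoidAlgebra K (N ⋊[θ] Q) ⊗[K] MonoidAlgebra K (N ⋊[θ] Q)) =
    ∑ ν : N →* Kˣ, charIdem (K := K) (SemidirectProduct.inl : N →* N ⋊[θ] Q) ν ⊗ₜ[K]
      MonoidAlgebra.single (SemidirectProduct.inr (charToQ f ν)⁻¹ : N ⋊[θ] Q) (1 : K) := by
  classical
  rw [Units.inv_eq_of_mul_eq_one_right]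
  rw [twistOfIso_val, sum_tmul_mul_aux _ (fun ν μ => charIdem_mul _ ν μ)]
  simp_rw [MonoidAlgebra.single_mul_single, ← map_mul, mul_inv_cancel, map_one, mul_one,
    ← MonoidAlgebra.one_def, ← TensorProduct.sum_tmul]
  rw [sum_charIdem]
  rfl

lemma twist_mul_tmul (ν μ : N →* Kˣ) (q r : Q) :
    ((twistOfIso hLP f).val : MonoidAlgebra K (N ⋊[θ] Q) ⊗[K] MonoidAlgebra K (N ⋊[θ] Q)) *
      (idemMul K θ ν q ⊗ₜ[K] idemMul K θ μ r) =
      idemMul K θ ν q ⊗ₜ[K] idemMul K θ (charAct K θ (charToQ f ν) μ) (charToQ f ν * r) := by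
  classical
  rw [twistOfIso_val, Finset.sum_mul, Finset.sum_eq_single ν]
  · rw [Algebra.TensorProduct.tmul_mul_tmul, charIdem_mul_idemMul, if_pos rfl, single_mul_idemMul]
  · intro η _ hη
    rw [Algebra.TensorProduct.tmul_mul_tmul, charIdem_mul_idemMul, if_neg hη,
      TensorProduct.zero_tmul]
  · simp

lemma tmul_mul_twist_inv (ν μ : N →* Kˣ) (q r : Q) :
    (idemMul K θ ν q ⊗ₜ[K] idemMul K θ μ r) * (↑(twistOfIso hLP f).val⁻¹ : MonoidAlgebra K (N ⋊[θ] Q) ⊗[K] MonoidAlgebra K (N ⋊[θ] Q)) =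
      idemMul K θ ν q ⊗ₜ[K] idemMul K θ μ (r * (charToQ f (charAct K θ q⁻¹ ν))⁻¹) := by
  classical
  rw [twistOfIso_inv, Finset.mul_sum, Finset.sum_eq_single (charAct K θ q⁻¹ ν)]
  · rw [Algebra.TensorProduct.tmul_mul_tmul, idemMul_mul_charIdem, if_pos rfl, idemMul_mul_single]
  · intro η _ hη
    rw [Algebra.TensorProduct.tmul_mul_tmul, idemMul_mul_charIdem, if_neg hη.symm,
      TensorProduct.zero_tmul]
  · simp

lemma twist_comul_idemMul (ν : N →* Kˣ) (q : Q) :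
    ((twistOfIso hLP f).val : MonoidAlgebra K (N ⋊[θ] Q) ⊗[K] MonoidAlgebra K (N ⋊[θ] Q)) *
      Coalgebra.comul (idemMul K θ ν q) * (↑(twistOfIso hLP f).val⁻¹ : MonoidAlgebra K (N ⋊[θ] Q) ⊗[K] MonoidAlgebra K (N ⋊[θ] Q)) =
      ∑ η : N →* Kˣ, idemMul K θ η q ⊗ₜ[K] idemMul K θ (charAct K θ (charToQ f η) (η⁻¹ * ν))
        (charToQ f η * q * (charToQ f (charAct K θ q⁻¹ η))⁻¹) := by
  rw [comul_idemMul, Finset.mul_sum, Finset.sum_mul]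
  refine Finset.sum_congr rfl fun η _ => ?_
  rw [twist_mul_tmul, tmul_mul_twist_inv]

lemma twist_U : (twistOfIso hLP f).U =
    ∑ ν : N →* Kˣ, idemMul K θ ν (charToQ f ν)⁻¹ := by
  rw [DrinfeldTwist.U, twistOfIso_val, map_sum, map_sum]
  refine Finset.sum_congr rfl fun ν _ => ?_
  rw [LinearMap.lTensor_tmul, LinearMap.mul'_apply, MonoidAlgebra.antipode_single]
  simp [idemMul]

lemma twist_Uinv : (twistOfIso hLP f).Uinv =
    ∑ ν : N →* Kˣ, idemMul K θ ν (charToQ f ν) := by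
  rw [DrinfeldTwist.Uinv, twistOfIso_inv, map_sum, map_sum]
  refine Fintype.sum_equiv (Equiv.inv _) _ _ fun ν => ?_
  rw [LinearMap.rTensor_tmul, LinearMap.mul'_apply, antipode_charIdem]
  simp [idemMul]

lemma twist_antipode_idemMul (ν : N →* Kˣ) (q : Q) :
    (twistOfIso hLP f).U * HopfAlgebra.antipode K (idemMul K θ ν q) * (twistOfIso hLP f).Uinv =
      idemMul K θ (charAct K θ (charToQ f (charAct K θ q⁻¹ ν)) (charAct K θ q⁻¹ ν⁻¹))
        (charToQ f (charAct K θ q⁻¹ ν) * q⁻¹ * (charToQ f ν)⁻¹) := by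
  classical
  have h1 : HopfAlgebra.antipode K (idemMul K θ ν q) =
      idemMul K θ (charAct K θ q⁻¹ ν⁻¹) q⁻¹ := by
    rw [idemMul, HopfAlgebra.antipode_mul_antidistrib, antipode_charIdem,
      MonoidAlgebra.antipode_single]
    simpa using single_inr_mul_charIdem (θ := θ) q⁻¹ ν⁻¹
  set κ := charAct K θ (charToQ f (charAct K θ q⁻¹ ν)) (charAct K θ q⁻¹ ν⁻¹) with hκ
  have hpκ : charToQ f κ = (charToQ f (charAct K θ q⁻¹ ν))⁻¹ := by
    rw [hκ, charToQ_charAct hLP f (charToQ_mem f _), map_inv (charAct K θ q⁻¹), map_inv]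
  have h2 : (twistOfIso hLP f).U * idemMul K θ (charAct K θ q⁻¹ ν⁻¹) q⁻¹ =
      idemMul K θ κ (charToQ f (charAct K θ q⁻¹ ν) * q⁻¹) := by
    rw [twist_U, Finset.sum_mul, Finset.sum_eq_single κ]
    · rw [idemMul_mul, hpκ, inv_inv, if_pos rfl]
    · intro η _ hη
      rw [idemMul_mul, if_neg]
      intro h
      apply hη
      have h3 : charToQ f η = (charToQ f (charAct K θ q⁻¹ ν))⁻¹ := by
        rw [h, charToQ_charAct hLP f (inv_mem (charToQ_mem f _)), map_inv (charAct K θ q⁻¹),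
          map_inv]
      rw [h, h3, inv_inv]
    · simp
  have h4 : charAct K θ (charToQ f (charAct K θ q⁻¹ ν) * q⁻¹)⁻¹ κ = ν⁻¹ := by
    rw [hκ, ← MulAut.mul_apply, ← MulAut.mul_apply, ← map_mul, ← map_mul]
    simp
  rw [h1, h2, twist_Uinv, Finset.mul_sum, Finset.sum_eq_single ν⁻¹]
  · rw [idemMul_mul, if_pos, map_inv (charToQ f)]
    rw [← h4, ← MulAut.mul_apply, ← map_mul, mul_inv_cancel, map_one, MulAut.one_apply]
  · intro η _ hη
    rw [idemMul_mul, if_neg]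
    intro h
    apply hη
    rw [← h4, h, ← MulAut.mul_apply, ← map_mul, inv_mul_cancel, map_one, MulAut.one_apply]
  · simp

open scoped Classical in
/-- The basis `e_ν q` of the twisted group algebra is of bismash type. -/
noncomputable def twistedBasis :
    BismashBasis K (N →* Kˣ) Q (twistOfIso hLP f).Twisted where
  act := charAct K θ
  p := charToQ f
  p_act x y := charToQ_charAct hLP f (charToQ_mem f x) y
  basis := (idemBasis K θ).map (twistOfIso hLP f).toTwisted.toLinearEquiv
  mul' x q y r := by
    simp only [Module.Basis.map_apply, idemBasis_apply, AlgEquiv.toLinearEquiv_apply]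
    rw [← map_mul, idemMul_mul]
    split_ifs <;> simp
  one' := by
    simp only [Module.Basis.map_apply, idemBasis_apply, AlgEquiv.toLinearEquiv_apply]
    rw [← map_sum, sum_idemMul, map_one, ← MonoidAlgebra.one_def, map_one]
  comul' x q := by
    simp only [Module.Basis.map_apply, idemBasis_apply, AlgEquiv.toLinearEquiv_apply]
    rw [DrinfeldTwist.comul_toTwisted, twist_comul_idemMul, map_sum]
    rfl
  counit' x q := by
    simp only [Module.Basis.map_apply, idemBasis_apply, AlgEquiv.toLinearEquiv_apply]
    rw [DrinfeldTwist.counit_toTwisted, idemMul, Bialgebra.counit_mul, counit_charIdem,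
      MonoidAlgebra.counit_single]
    simp
  antipode' x q := by
    simp only [Module.Basis.map_apply, idemBasis_apply, AlgEquiv.toLinearEquiv_apply]
    rw [DrinfeldTwist.antipode_toTwisted, twist_antipode_idemMul]

end Semidirect

/-! ### The hypotheses on `N`, `Q` and `τ` -/

section Semidirect

attribute [local instance] Fintype.ofFinite

variable {K N Q : Type*} [Field K] [CommGroup N] [Group Q] {θ : Q →* MulAut N}

lemma mem_fixedChars_iff {q : Q} {ν : N →* Kˣ} :
    ν ∈ fixedChars K θ q ↔ charAct K θ q ν = ν :=
  ⟨fun h => MonoidHom.ext h, fun h n => DFunLike.congr_fun h n⟩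

lemma char_eq_one_of_isCompl {L : Subgroup N} {τ : Q}
    (hdecomp : IsCompl L (L.map (θ τ).toMonoidHom)) {ν : N →* Kˣ} (h1 : ∀ l ∈ L, ν l = 1)
    (h2 : ∀ l ∈ L, ν (θ τ l) = 1) : ν = 1 := by
  have h3 : L ⊔ L.map (θ τ).toMonoidHom ≤ ν.ker := by
    refine sup_le h1 ?_
    rintro _ ⟨l, hl, rfl⟩
    exact h2 l hl
  rw [hdecomp.sup_eq_top] at h3
  exact MonoidHom.ext fun n => h3 (Subgroup.mem_top n)

lemma eq_one_of_isCompl (hfaithful : Function.Injective θ) {L : Subgroup N} {τ : Q}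
    (hdecomp : IsCompl L (L.map (θ τ).toMonoidHom)) {q : Q} (h1 : ∀ l ∈ L, θ q l = l)
    (h2 : ∀ l ∈ L, θ q (θ τ l) = θ τ l) : q = 1 := by
  have h3 : L ⊔ L.map (θ τ).toMonoidHom ≤ (θ q).toMonoidHom.eqLocus (MonoidHom.id N) := by
    refine sup_le h1 ?_
    rintro _ ⟨l, hl, rfl⟩
    exact h2 l hl
  rw [hdecomp.sup_eq_top] at h3
  apply hfaithful
  rw [map_one]
  exact MulEquiv.ext fun n => h3 (Subgroup.mem_top n)

variable [Finite N] [HasEnoughRootsOfUnity K (Monoid.exponent N)]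

lemma charAct_injective (hfaithful : Function.Injective θ) : Function.Injective (charAct K θ) := by
  intro q r h
  apply inv_injective
  apply hfaithful
  ext n
  by_contra hne
  obtain ⟨ν, hν⟩ := CommGroup.exists_apply_ne_one_of_hasEnoughRootsOfUnity N K
    (a := θ q⁻¹ n / θ r⁻¹ n) (fun h => hne (div_eq_one.mp h))
  apply hν
  rw [map_div, div_eq_one]
  exact DFunLike.congr_fun (DFunLike.congr_fun h ν) n

/-- An automorphism of `N` with a nontrivial fixed point fixes a nontrivial character: the
characters it fixes are those of the cokernel of `n ↦ τ(n) n⁻¹`, whose kernel is the group of fixed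
points. -/
lemma exists_fixed_char {τ : Q} (hfix : ∃ n : N, θ τ n = n ∧ n ≠ 1) :
    ∃ ν : N →* Kˣ, ν ≠ 1 ∧ charAct K θ τ ν = ν := by
  obtain ⟨n, hn, hn1⟩ := hfix
  let d : N →* N := (θ τ).toMonoidHom / MonoidHom.id N
  have hd : ¬ Function.Surjective d := by
    rw [← Finite.injective_iff_surjective]
    intro h
    apply hn1
    apply h
    simp [d, hn]
  obtain ⟨m, hm⟩ := not_forall.mp hd
  have : NeZero (Monoid.exponent N) := ⟨Monoid.exponent_ne_zero_of_finite⟩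
  have : HasEnoughRootsOfUnity K (Monoid.exponent (N ⧸ d.range)) :=
    HasEnoughRootsOfUnity.of_dvd K (n := Monoid.exponent N)
      (MonoidHom.exponent_dvd (f := QuotientGroup.mk' d.range) (QuotientGroup.mk'_surjective _))
  obtain ⟨χ, hχ⟩ := CommGroup.exists_apply_ne_one_of_hasEnoughRootsOfUnity (N ⧸ d.range) K
    (a := (m : N ⧸ d.range)) (fun h => hm ((QuotientGroup.eq_one_iff m).mp h))
  refine ⟨χ.comp (QuotientGroup.mk' d.range), fun h => hχ (DFunLike.congr_fun h m), ?_⟩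
  ext x
  change ((χ (θ τ⁻¹ x : N) : Kˣ) : K) = χ (x : N)
  congr 2
  refine QuotientGroup.eq.mpr ⟨θ τ⁻¹ x, ?_⟩
  simp [d, div_eq_inv_mul, mul_comm]

variable [CharZero K] [Finite Q] {L : Subgroup N} {P : Subgroup Q} [IsMulCommutative P]
  (hLP : ∀ l ∈ L, ∀ σ ∈ P, Commute (SemidirectProduct.inl l : N ⋊[θ] Q)
      (SemidirectProduct.inr σ)) (f : P ≃* (L →* Kˣ))

open scoped Classical in
/-- The double coset of `τ` is isolating. -/
lemma isIsolating_doubleCoset {τ : Q} (hfaithful : Function.Injective θ)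
    (hdecomp : IsCompl L (L.map (θ τ).toMonoidHom)) (hfix : ∃ n : N, θ τ n = n ∧ n ≠ 1)
    (hchar : ∀ σ ∈ P, σ ≠ 1 → fixedChars K θ (σ * τ) = ⊥ ∧
      fixedChars K θ τ ⊓ fixedChars K θ (σ * τ * σ⁻¹) = ⊥) :
    (twistedBasis hLP f).IsIsolating
      (Finset.univ.filter fun q => ∃ α β, q = charToQ f α * τ * charToQ f β) := by
  set D := twistedBasis hLP f
  have hp : D.p = charToQ f := rfl
  have hact : D.act = charAct K θ := rfl
  have hker : ∀ q, (∃ α β, q = charToQ f α * τ * charToQ f β) → ∀ α, D.p α = 1 →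
      D.p (D.act q⁻¹ α) = 1 → α = 1 := by
    rintro _ ⟨β, γ, rfl⟩ α h1 h2
    rw [hp, charToQ_eq_one_iff] at h1 h2
    have h3 : D.act (charToQ f β)⁻¹ α = 1 := by
      refine char_eq_one_of_isCompl hdecomp (fun l hl => ?_) (fun l hl => ?_)
      · rw [hact, charAct_apply, inv_inv, act_eq_of_commute hLP hl (charToQ_mem f β)]
        exact h1 l hl
      · have h4 := h2 l hl
        rw [hact, charAct_apply, inv_inv, map_mul, map_mul, MulAut.mul_apply, MulAut.mul_apply,
          act_eq_of_commute hLP hl (charToQ_mem f γ)] at h4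
        rw [hact, charAct_apply, inv_inv]
        exact h4
    rwa [EmbeddingLike.map_eq_one_iff] at h3
  -- Conjugation turns a fixed point of `σ₁ τ σ₂` into one of `σ₂ σ₁ τ`, so `σ₂ = σ₁⁻¹`.
  have hnf : ∀ q, (∃ α β, q = charToQ f α * τ * charToQ f β) → ∀ x, x ≠ 1 → D.act q x = x →
      ∃ α, q = charToQ f α * τ * (charToQ f α)⁻¹ := by
    rintro _ ⟨α, β, rfl⟩ x hx hqx
    refine ⟨α, ?_⟩
    congr 1
    rw [← mul_eq_one_iff_eq_inv]
    by_contra hne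
    have h1 := (hchar _ (mul_mem (charToQ_mem f β) (charToQ_mem f α)) hne).1
    have h2 : D.act (charToQ f β) x ∈ fixedChars K θ (charToQ f β * charToQ f α * τ) := by
      rw [mem_fixedChars_iff]
      change D.act _ _ = _
      rw [← D.act_mul]
      conv_rhs => rw [← hqx, ← D.act_mul]
      simp only [mul_assoc]
    rw [h1, Subgroup.mem_bot, EmbeddingLike.map_eq_one_iff] at h2
    exact hx h2
  refine ⟨?_, ?_, ?_, ?_, ?_, ?_⟩
  · intro q hq α β
    obtain ⟨γ, δ, rfl⟩ := (Finset.mem_filter.mp hq).2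
    refine Finset.mem_filter.mpr ⟨Finset.mem_univ _, α * γ, δ * β, ?_⟩
    rw [hp, map_mul, map_mul]
    simp only [mul_assoc]
  · intro q hq α hα
    have hq' := (Finset.mem_filter.mp hq).2
    obtain ⟨β, γ, hqe⟩ := hq'
    rw [BismashBasis.tgt, mul_inv_eq_iff_eq_mul] at hα
    set σ := D.p (D.act q⁻¹ α) with hσ
    have hσP : σ ∈ P := charToQ_mem f _
    have hα1 : D.p α = 1 := by
      -- `p(α)` is conjugate by `τ` to an element of `P`, so it fixes `L` and `τ(L)` pointwise
      have h1 : D.p α * τ = τ * (charToQ f γ * σ * (charToQ f γ)⁻¹) := by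
        have h2 : D.p α * (charToQ f β) = charToQ f β * D.p α := D.p_comm α β
        have h3 : charToQ f β * (D.p α * τ) =
            charToQ f β * (τ * (charToQ f γ * σ * (charToQ f γ)⁻¹)) := by
          rw [← mul_assoc, ← h2]
          have h4 := congrArg (· * (charToQ f γ)⁻¹) hα
          simp only [hqe] at h4
          simpa [mul_assoc] using h4
        exact mul_left_cancel h3
      refine eq_one_of_isCompl hfaithful hdecomp
        (fun l hl => act_eq_of_commute hLP hl (charToQ_mem f α)) (fun l hl => ?_)
      rw [← MulAut.mul_apply, ← map_mul, h1, map_mul, MulAut.mul_apply,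
        act_eq_of_commute hLP hl (mul_mem (mul_mem (charToQ_mem f γ) hσP)
          (inv_mem (charToQ_mem f γ)))]
    refine hker q ⟨β, γ, hqe⟩ α hα1 ?_
    rw [hα1, one_mul] at hα
    exact (mul_eq_left (a := q)).mp hα.symm
  · intro q hq
    exact hker q (Finset.mem_filter.mp hq).2
  · intro q hq r hr x hx hqx hrx
    obtain ⟨α, rfl⟩ := hnf q (Finset.mem_filter.mp hq).2 x hx hqx
    obtain ⟨β, rfl⟩ := hnf r (Finset.mem_filter.mp hr).2 x hx hrx
    by_cases hne : (charToQ f α)⁻¹ * charToQ f β = 1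
    · rw [inv_mul_eq_one.mp hne]
    · exfalso
      have h1 := (hchar _ (mul_mem (inv_mem (charToQ_mem f α)) (charToQ_mem f β)) hne).2
      have h2 : D.act (charToQ f α)⁻¹ x ∈ fixedChars K θ τ ⊓
          fixedChars K θ ((charToQ f α)⁻¹ * charToQ f β * τ *
            ((charToQ f α)⁻¹ * charToQ f β)⁻¹) := by
        refine Subgroup.mem_inf.mpr ⟨mem_fixedChars_iff.mpr ?_, mem_fixedChars_iff.mpr ?_⟩
        · change D.act _ _ = _
          conv_rhs => rw [← hqx, ← D.act_mul]
          rw [← D.act_mul]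
          simp only [mul_assoc, inv_mul_cancel_left]
        · change D.act _ _ = _
          conv_rhs => rw [← hrx, ← D.act_mul]
          rw [← D.act_mul]
          simp only [mul_assoc, mul_inv_rev, inv_inv, mul_inv_cancel, mul_one]
      rw [h1, Subgroup.mem_bot, EmbeddingLike.map_eq_one_iff] at h2
      exact hx h2
  · intro q hq r hr x hx y hy hqx hry
    obtain ⟨α, rfl⟩ := hnf q (Finset.mem_filter.mp hq).2 x hx hqx
    obtain ⟨β, rfl⟩ := hnf r (Finset.mem_filter.mp hr).2 y hy hry
    refine ⟨β * α⁻¹, ?_⟩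
    have h : charToQ f (β * α⁻¹) = charToQ f β * (charToQ f α)⁻¹ := by
      rw [map_mul, MonoidHom.map_inv]
    change _ = charToQ f (β * α⁻¹) * _ * (charToQ f (β * α⁻¹))⁻¹
    rw [h]
    group
  · obtain ⟨ν, hν1, hν⟩ := exists_fixed_char (K := K) hfix
    exact ⟨τ, Finset.mem_filter.mpr ⟨Finset.mem_univ _, 1, 1, by simp⟩, ν, hν1, hν⟩

omit [CharZero K] [Finite Q] [HasEnoughRootsOfUnity K (Monoid.exponent N)] in
lemma charIdem_eq_idemMul (ν : N →* Kˣ) :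
    (charIdem SemidirectProduct.inl ν : MonoidAlgebra K (N ⋊[θ] Q)) = idemMul K θ ν 1 := by
  rw [idemMul, map_one, ← MonoidAlgebra.one_def, mul_one]

open scoped Classical in
lemma twistedBasis_basis (g : (N →* Kˣ) × Q) :
    (twistedBasis hLP f).basis g = (twistOfIso hLP f).toTwisted (idemMul K θ g.1 g.2) := by
  obtain ⟨ν, q⟩ := g
  simp only [twistedBasis, Module.Basis.map_apply, idemBasis_apply, AlgEquiv.toLinearEquiv_apply]

open scoped Classical in
/-- The algebra generated by the idempotents of `KN` and by `Q` is the span of the elements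
`e_ν q`. -/
lemma orderNQ_eq_span (R : Type*) [CommRing R] [Algebra R K] [IsFractionRing R K] :
    orderNQ R (twistOfIso hLP f) = Submodule.span R (Set.range (twistedBasis hLP f).basis) := by
  set D := twistedBasis hLP f
  have hS : IsHopfOrder R K (Submodule.span R (Set.range D.basis)) := D.isHopfOrder_span
  let S : Subalgebra R (twistOfIso hLP f).Twisted :=
    (Submodule.span R (Set.range D.basis)).toSubalgebra hS.one_mem
      (fun a b ha hb => hS.mul_mem a ha b hb)
  have hmem : ∀ ν q, (twistOfIso hLP f).toTwisted (idemMul K θ ν q) ∈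
      Submodule.span R (Set.range D.basis) := fun ν q =>
    Submodule.subset_span ⟨(ν, q), twistedBasis_basis hLP f (ν, q)⟩
  refine le_antisymm ?_ (Submodule.span_le.mpr ?_)
  · have h : Algebra.adjoin R ((twistOfIso hLP f).toTwisted ''
        (Set.range (fun ν : N →* Kˣ => charIdem SemidirectProduct.inl ν) ∪
          Set.range (fun q : Q => MonoidAlgebra.single (SemidirectProduct.inr q) (1 : K)))) ≤ S := by
      refine Algebra.adjoin_le ?_
      rintro _ ⟨_, ⟨ν, rfl⟩ | ⟨q, rfl⟩, rfl⟩
      · dsimp only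
        rw [charIdem_eq_idemMul]
        exact hmem ν 1
      · dsimp only
        rw [← sum_idemMul (θ := θ), map_sum]
        exact Submodule.sum_mem _ fun ν _ => hmem ν q
    exact h
  · rintro _ ⟨⟨ν, q⟩, rfl⟩
    rw [twistedBasis_basis, idemMul, map_mul]
    refine Subalgebra.mul_mem _ (Algebra.subset_adjoin ?_) (Algebra.subset_adjoin ?_)
    · exact ⟨_, Or.inl ⟨ν, rfl⟩, rfl⟩
    · exact ⟨_, Or.inr ⟨q, rfl⟩, rfl⟩

open scoped Classical in
/-- The uniqueness holds over every integrally closed domain `R` with fraction field `K` of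
characteristic zero. -/
theorem isHopfOrder_iff_eq_orderNQ (R : Type*) [CommRing R] [Algebra R K] [IsFractionRing R K]
    [IsIntegrallyClosed R] {τ : Q} (hfaithful : Function.Injective θ)
    (hdecomp : IsCompl L (L.map (θ τ).toMonoidHom)) (hfix : ∃ n : N, θ τ n = n ∧ n ≠ 1)
    (hchar : ∀ σ ∈ P, σ ≠ 1 → fixedChars K θ (σ * τ) = ⊥ ∧
      fixedChars K θ τ ⊓ fixedChars K θ (σ * τ * σ⁻¹) = ⊥)
    (Y : Submodule R (twistOfIso hLP f).Twisted) :
    IsHopfOrder R K Y ↔ Y = orderNQ R (twistOfIso hLP f) := by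
  rw [orderNQ_eq_span]
  refine ⟨fun hY => ?_, fun h => h ▸ (twistedBasis hLP f).isHopfOrder_span⟩
  refine (twistedBasis hLP f).eq_span_of_b_one_mem hY (charAct_injective hfaithful) fun ν => ?_
  exact (twistedBasis hLP f).b_one_mem hY
    (isIsolating_doubleCoset hLP f hfaithful hdecomp hfix hchar) ν

end Semidirect

theorem mainTheorem2 {K N Q : Type*} [Field K] [NumberField K]
    [CommGroup N] [Finite N] [Group Q] [Finite Q] (θ : Q →* MulAut N)
    [HasEnoughRootsOfUnity K (Monoid.exponent N)]
    (L : Subgroup N) (P : Subgroup Q) [IsMulCommutative P] (τ : Q)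
    (hiso : Nonempty (L ≃* P))
    (hLP : ∀ l ∈ L, ∀ σ ∈ P, Commute (SemidirectProduct.inl l : N ⋊[θ] Q)
      (SemidirectProduct.inr σ))
    (hfaithful : Function.Injective θ)
    (hdecomp : IsCompl L (L.map (θ τ).toMonoidHom))
    (hfix : ∃ n : N, θ τ n = n ∧ n ≠ 1)
    (hchar : ∀ σ ∈ P, σ ≠ 1 →
      fixedChars K θ (σ * τ) = ⊥ ∧
        fixedChars K θ τ ⊓ fixedChars K θ (σ * τ * σ⁻¹) = ⊥)
    (f : P ≃* (L →* Kˣ)) :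
    IsHopfOrder (NumberField.RingOfIntegers K) K
        (orderNQ (NumberField.RingOfIntegers K) (twistOfIso hLP f)) ∧
      ∀ Y : Submodule (NumberField.RingOfIntegers K) (twistOfIso hLP f).Twisted,
        IsHopfOrder (NumberField.RingOfIntegers K) K Y →
          Y = orderNQ (NumberField.RingOfIntegers K) (twistOfIso hLP f) := by
  have h := isHopfOrder_iff_eq_orderNQ hLP f (NumberField.RingOfIntegers K) hfaithful hdecomp
    hfix hchar
  exact ⟨(h _).mpr rfl, fun Y => (h Y).mp⟩
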